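/- Let $(M^{q+1},g)$ be a smooth Riemannian manifold with a Riemannian flow given by a smooth unit vector field $\xi$, that is, $\mathcal L_\xi g=0$ on $Q=\xi^\perp$ (so $q=\operatorname{rk}Q$ is the codimension of the flow). Let $\nabla^M$ be the Levi-Civita connection and let $h=\nabla^M\xi:Q\to Q$, $h(X)=\nabla^M_X\xi$, be the O'Neill tensor. Put $m=\lfloor q/2\rfloor$, and for $X,Y,Z,W\in Q$ let $$g(R_{\rm ext}(X\wedge Y),Z\wedge W)=2g(h(X),Y)\,g(h(Z),W)-g(h(Y),Z)\,g(h(X),W)-g(h(Z),X)\,g(h(Y),W).$$ For a vector $X\in Q$ and a $k$-form $\omega$ on $Q$ let $X\cdot\omega=X\wedge\omega-X\lrcorner\omega$ and $\omega\cdot X=(-1)^k(X\wedge\omega+X\lrcorner\omega)$, and for orthogonal $X,Y$ let $[X\wedge Y,\omega]=X\cdot(Y\cdot\omega)-(\omega\cdot X)\cdot Y$. For $p$-forms $\omega,\varphi$ on $Q$ and an orthonormal basis $f_1,\dots,f_q$ of $Q$ let $$\langle\mathcal B^{[p]}_{\rm ext}\omega,\varphi\rangle=\frac14\sum_{i<j}\sum_{k<l}g(R_{\rm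 ext}(f_i\wedge f_j),f_k\wedge f_l)\,\langle[f_i\wedge f_j,\omega],[f_k\wedge f_l,\varphi]\rangle,$$ where the scalar product of forms is the one for which the products $f_{i_1}\wedge\dots\wedge f_{i_k}$ with $i_1<\dots<i_k$ are orthonormal. Let $1\le p\le q-1$, let $\omega$ be a basic $p$-form (a smooth $p$-form on $M$ with $\xi\lrcorner\omega=0$ and $\xi\lrcorner d\omega=0$), and let $x\in M$. Then $Q_x$ has an orthonormal basis $(e_i)_{1\le i\le q}$ in which $h_x$ has the normal form $$h(e_{2i-1})=b_ie_{2i},\qquad h(e_{2i})=-b_ie_{2i-1}\quad(1\le i\le m),\qquad h(e_q)=0\ \text{ if $q$ is odd},\qquad |b_1|\le\dots\le|b_m|.$$ For every such basis, with skew-eigenvalues $b_1,\dots,b_m$, and for every choice of $(f_i)$, one has at $x$ $$\langle\mathcal B^{[p]}_{\rm ext}\omega,\omega\rangle\ \ge\ -p(q-p)\,b_m^2\,|\omega|^2 .$$ Suppose moreover that $\omega_x\ne0$ and that equality holds at $x$. If $p\le m$, then $|b_1|=\dots=|b_m|$ at $x$. If $m=1$, then $b_1=0$ at $x$. -/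

import Mathlib

open scoped Manifold ContDiff Bundle
open Bundle

noncomputable section

namespace RiemannianFlow

section LinearAlgebra

variable {V : Type*} [NormedAddCommGroup V] [InnerProductSpace ℝ V] {q : ℕ}

/-- Exterior forms of mixed degree on `V`: a family of alternating forms, one in each degree. -/
abbrev MixedForm (V : Type*) [NormedAddCommGroup V] [InnerProductSpace ℝ V] : Type _ :=
  ∀ k : ℕ, V [⋀^Fin k]→ₗ[ℝ] ℝ

/-- A form of pure degree `p`, seen as a form of mixed degree. -/
def ofDegree {p : ℕ} (η : V [⋀^Fin p]→ₗ[ℝ] ℝ) : MixedForm V :=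
  Pi.single p η

/-- The exterior product `X ∧ α`, where `X` is identified with the `1`-form `⟪X, ·⟫`:
`(X ∧ α)(v₀, …, vₖ) = ∑ᵢ (-1)ⁱ ⟪X, vᵢ⟫ α(v₀, …, v̂ᵢ, …, vₖ)`. -/
def wedge (X : V) (α : MixedForm V) : MixedForm V
  | 0 => 0
  | k + 1 => AlternatingMap.alternatizeUncurryFin
      ((innerₗ V X).smulRight (α k))

/-- The interior product `X ⌟ α = α(X, ·, …, ·)`. -/
def contract (X : V) (α : MixedForm V) : MixedForm V :=
  fun k => (α (k + 1)).curryLeft X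

/-- The sign `(-1)ᵏ` in degree `k`. -/
def degreeSign (α : MixedForm V) : MixedForm V :=
  fun k => (-1 : ℝ) ^ k • α k

/-- Clifford multiplication on the left, `X · α = X ∧ α - X ⌟ α`. -/
def cliffordLeft (X : V) (α : MixedForm V) : MixedForm V :=
  wedge X α - contract X α

/-- Clifford multiplication on the right, `α · X = (-1)ᵏ (X ∧ α + X ⌟ α)` for `α` of degree `k`. -/
def cliffordRight (α : MixedForm V) (X : V) : MixedForm V :=
  wedge X (degreeSign α) + contract X (degreeSign α)

/-- The Clifford commutator `[X ∧ Y, α] = (X ∧ Y) · α - α · (X ∧ Y)` for orthogonal vectors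
`X` and `Y`, in which case `X ∧ Y = X · Y`. -/
def cliffordBracket (X Y : V) (α : MixedForm V) : MixedForm V :=
  cliffordLeft X (cliffordLeft Y α) - cliffordRight (cliffordRight α X) Y

/-- The scalar product of `k`-forms for which the products `eᵢ₁ ∧ ⋯ ∧ eᵢₖ`, `i₁ < ⋯ < iₖ`, of an
orthonormal basis are orthonormal. The sum runs over all `k`-tuples of indices, hence the `k!`. -/
def formInner (e : OrthonormalBasis (Fin q) ℝ V) {k : ℕ} (α β : V [⋀^Fin k]→ₗ[ℝ] ℝ) : ℝ :=
  (k.factorial : ℝ)⁻¹ * ∑ v : Fin k → Fin q, α (fun i => e (v i)) * β (fun i => e (v i))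

/-- The scalar product of forms of mixed degree (different degrees are orthogonal); forms of degree
larger than `q = dim V` vanish. -/
def mixedInner (e : OrthonormalBasis (Fin q) ℝ V) (α β : MixedForm V) : ℝ :=
  ∑ k ∈ Finset.range (q + 1), formInner e (α k) (β k)

/-- The exterior curvature tensor `g(R_ext(X ∧ Y), Z ∧ W)` of an endomorphism `h`. -/
def extCurvature (h : V →ₗ[ℝ] V) (X Y Z W : V) : ℝ :=
  2 * inner ℝ (h X) Y * inner ℝ (h Z) W - inner ℝ (h Y) Z * inner ℝ (h X) W
    - inner ℝ (h Z) X * inner ℝ (h Y) W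

/-- The exterior part of the Bochner operator, as the bilinear form `⟨B_ext η, ζ⟩` on `p`-forms:
`(1/4) ∑_{r,s} ⟨R_ext ψ_r, ψ_s⟩ ⟨[ψ_r, η], [ψ_s, ζ]⟩`, where `ψ_r` runs through the orthonormal
basis `eᵢ ∧ eⱼ`, `i < j`, of the `2`-vectors (and the dual one of the `2`-forms). -/
def bochnerExt (e : OrthonormalBasis (Fin q) ℝ V) (h : V →ₗ[ℝ] V) {p : ℕ}
    (η ζ : V [⋀^Fin p]→ₗ[ℝ] ℝ) : ℝ :=
  (1 / 4 : ℝ) * ∑ r : Fin q × Fin q with r.1 < r.2, ∑ s : Fin q × Fin q with s.1 < s.2,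
    extCurvature h (e r.1) (e r.2) (e s.1) (e s.2) *
      mixedInner e (cliffordBracket (e r.1) (e r.2) (ofDegree η))
        (cliffordBracket (e s.1) (e s.2) (ofDegree ζ))

/-- The orthonormal basis `e` puts the skew-symmetric endomorphism `h` in normal form, with
skew-eigenvalues `b₁, …, b_m`, `m = ⌊q/2⌋`, ordered by absolute value. In the usual numbering from
`1`: `h e_{2i-1} = bᵢ e_{2i}`, `h e_{2i} = -bᵢ e_{2i-1}`, `h` kills the remaining basis vector when
`q` is odd, and `|b₁| ≤ ⋯ ≤ |b_m|`. Here the numbering starts at `0`. -/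
structure IsSkewNormalForm (h : V →ₗ[ℝ] V) (e : OrthonormalBasis (Fin q) ℝ V)
    (b : Fin (q / 2) → ℝ) : Prop where
  map_fst : ∀ i : Fin (q / 2),
    h (e ⟨2 * (i : ℕ), by omega⟩) = b i • e ⟨2 * (i : ℕ) + 1, by omega⟩
  map_snd : ∀ i : Fin (q / 2),
    h (e ⟨2 * (i : ℕ) + 1, by omega⟩) = -(b i • e ⟨2 * (i : ℕ), by omega⟩)
  map_rest : ∀ j : Fin q, 2 * (q / 2) ≤ (j : ℕ) → h (e j) = 0
  abs_mono : ∀ i j : Fin (q / 2), i ≤ j → |b i| ≤ |b j|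

end LinearAlgebra

section Forms

variable {n : ℕ} {M : Type*} [TopologicalSpace M] [ChartedSpace (EuclideanSpace ℝ (Fin n)) M]

/-- The expression of a differential `k`-form in the preferred chart at `x₀`. -/
def formInChart {k : ℕ} (η : ∀ x : M, TangentSpace (𝓡 n) x [⋀^Fin k]→L[ℝ] ℝ) (x₀ : M)
    (y : EuclideanSpace ℝ (Fin n)) : EuclideanSpace ℝ (Fin n) [⋀^Fin k]→L[ℝ] ℝ :=
  (η ((extChartAt (𝓡 n) x₀).symm y)).compContinuousLinearMap
    (mfderiv 𝓘(ℝ, EuclideanSpace ℝ (Fin n)) (𝓡 n) (extChartAt (𝓡 n) x₀).symm y)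

/-- Smooth differential forms. -/
def IsSmoothForm {k : ℕ} (η : ∀ x : M, TangentSpace (𝓡 n) x [⋀^Fin k]→L[ℝ] ℝ) : Prop :=
  ∀ x₀ : M, ContDiffOn ℝ ∞ (formInChart η x₀) (extChartAt (𝓡 n) x₀).target

/-- The exterior derivative of a differential form, computed at `x` in the preferred chart
at `x`. -/
def extDerivForm {k : ℕ} (η : ∀ x : M, TangentSpace (𝓡 n) x [⋀^Fin k]→L[ℝ] ℝ) (x : M) :
    TangentSpace (𝓡 n) x [⋀^Fin (k + 1)]→L[ℝ] ℝ :=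
  (extDeriv (formInChart η x) (extChartAt (𝓡 n) x x)).compContinuousLinearMap
    (mfderiv (𝓡 n) 𝓘(ℝ, EuclideanSpace ℝ (Fin n)) (extChartAt (𝓡 n) x) x)

/-- Basic forms of the foliation spanned by `ξ`: smooth forms `η` with `ξ ⌟ η = 0` and
`ξ ⌟ dη = 0`. -/
structure IsBasicForm (ξ : ∀ x : M, TangentSpace (𝓡 n) x) {k : ℕ}
    (η : ∀ x : M, TangentSpace (𝓡 n) x [⋀^Fin k]→L[ℝ] ℝ) : Prop where
  smooth : IsSmoothForm η
  contract_eq_zero : ∀ (x : M) (v : Fin k → TangentSpace (𝓡 n) x) (i : Fin k),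
    v i = ξ x → η x v = 0
  contract_extDeriv_eq_zero : ∀ (x : M) (v : Fin (k + 1) → TangentSpace (𝓡 n) x) (i : Fin (k + 1)),
    v i = ξ x → extDerivForm η x v = 0

end Forms

section Flow

variable {n : ℕ} {M : Type*} [TopologicalSpace M] [ChartedSpace (EuclideanSpace ℝ (Fin n)) M]
  [IsManifold (𝓡 n) ∞ M] [RiemannianBundle (fun x : M => TangentSpace (𝓡 n) x)]

/-- The Lie derivative `(L_ξ g)(X, Y) = ξ(g(X, Y)) - g([ξ, X], Y) - g(X, [ξ, Y])` of the metric. -/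
def lieDerivMetric (ξ X Y : ∀ x : M, TangentSpace (𝓡 n) x) (x : M) : ℝ :=
  mvfderiv (𝓡 n) (fun y => (inner ℝ (X y) (Y y) : ℝ)) x (ξ x)
    - inner ℝ (VectorField.mlieBracket (𝓡 n) ξ X x) (Y x)
    - inner ℝ (X x) (VectorField.mlieBracket (𝓡 n) ξ Y x)

/-- `ξ` is a smooth unit vector field whose integral curves form a Riemannian flow, i.e. the metric
is bundle-like: `L_ξ g = 0` on `ξ^⊥`. As `L_ξ g` is a tensor, this is a condition at each point,
on vector fields that are orthogonal to `ξ` at that point. -/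
structure IsRiemannianFlow (ξ : ∀ x : M, TangentSpace (𝓡 n) x) : Prop where
  smooth : ContMDiff (𝓡 n) (𝓡 n).tangent ∞
    (fun x => (⟨x, ξ x⟩ : TangentBundle (𝓡 n) M))
  unit : ∀ x : M, ‖ξ x‖ = 1
  lieDeriv_eq_zero : ∀ (X Y : ∀ x : M, TangentSpace (𝓡 n) x) (x : M),
    MDifferentiableAt (𝓡 n) (𝓡 n).tangent (fun y => (⟨y, X y⟩ : TangentBundle (𝓡 n) M)) x →
    MDifferentiableAt (𝓡 n) (𝓡 n).tangent (fun y => (⟨y, Y y⟩ : TangentBundle (𝓡 n) M)) x →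
    inner ℝ (ξ x) (X x) = 0 → inner ℝ (ξ x) (Y x) = 0 → lieDerivMetric ξ X Y x = 0

set_option synthInstance.maxHeartbeats 200000 in
/-- The Levi-Civita connection of the metric: torsion-free and compatible with the metric. -/
structure IsLeviCivita [IsContMDiffRiemannianBundle (𝓡 n) ∞ (EuclideanSpace ℝ (Fin n))
      (fun x : M => TangentSpace (𝓡 n) x)]
    (D : CovariantDerivative (𝓡 n) (EuclideanSpace ℝ (Fin n))
      (fun x : M => TangentSpace (𝓡 n) x)) : Prop where
  torsion_eq_zero : D.torsion = 0
  metric : D.IsMetricCompatible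

/-- The fibre at `x` of the normal bundle `Q = ξ^⊥`. -/
abbrev normalSpace (ξ : ∀ x : M, TangentSpace (𝓡 n) x) (x : M) :
    Submodule ℝ (TangentSpace (𝓡 n) x) :=
  (Submodule.span ℝ {ξ x})ᗮ

/-- The O'Neill tensor `h = ∇ξ`, as an endomorphism of `Q`. (For a unit field `ξ`, the vector
`∇_X ξ` is orthogonal to `ξ`, and the projection to `Q` changes nothing.) -/
def oneillTensor (D : CovariantDerivative (𝓡 n) (EuclideanSpace ℝ (Fin n))
      (fun x : M => TangentSpace (𝓡 n) x))
    (ξ : ∀ x : M, TangentSpace (𝓡 n) x) (x : M) : normalSpace ξ x →ₗ[ℝ] normalSpace ξ x :=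
  (normalSpace ξ x).orthogonalProjectionOnto.toLinearMap ∘ₗ (D ξ x).toLinearMap ∘ₗ
    (normalSpace ξ x).subtype

/-- The restriction of a differential form to `Q` at the point `x`. -/
def normalPart {k : ℕ} (ξ : ∀ x : M, TangentSpace (𝓡 n) x)
    (η : ∀ x : M, TangentSpace (𝓡 n) x [⋀^Fin k]→L[ℝ] ℝ) (x : M) :
    normalSpace ξ x [⋀^Fin k]→ₗ[ℝ] ℝ :=
  (η x).toAlternatingMap.compLinearMap (normalSpace ξ x).subtype

/-- `|η|²` at the point `x`, computed in the orthonormal basis `f` of `Q`. -/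
def normSqAt {q k : ℕ} {ξ : ∀ x : M, TangentSpace (𝓡 n) x} {x : M}
    (f : OrthonormalBasis (Fin q) ℝ (normalSpace ξ x))
    (η : ∀ x : M, TangentSpace (𝓡 n) x [⋀^Fin k]→L[ℝ] ℝ) : ℝ :=
  formInner f (normalPart ξ η x) (normalPart ξ η x)

/-- `⟨B_ext η, η⟩` at the point `x`, computed in the orthonormal basis `f` of `Q`. -/
def bochnerExtAt {q k : ℕ} (D : CovariantDerivative (𝓡 n) (EuclideanSpace ℝ (Fin n))
      (fun x : M => TangentSpace (𝓡 n) x))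
    {ξ : ∀ x : M, TangentSpace (𝓡 n) x} {x : M}
    (f : OrthonormalBasis (Fin q) ℝ (normalSpace ξ x))
    (η : ∀ x : M, TangentSpace (𝓡 n) x [⋀^Fin k]→L[ℝ] ℝ) : ℝ :=
  bochnerExt f (oneillTensor D ξ x) (normalPart ξ η x) (normalPart ξ η x)

end Flow

end RiemannianFlow

end

/-! Contraction and wedge satisfy the Clifford relations, and these give $[X\wedge
Y,\omega]=2\rho(X,Y)\omega$ with the infinitesimal rotation
$\rho(X,Y)\omega=Y\wedge(X\lrcorner\omega)-X\wedge(Y\lrcorner\omega)$ (`rot`). Inserting $R_{\rm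
ext}$ and using that $h$ is skew, one finds (`bochnerExt_eq`) $\langle\mathcal B_{\rm
ext}\omega,\omega\rangle=\frac12\bigl|\sum_i\rho(f_i,hf_i)\omega\bigr|^2+\frac12\sum_{i,j}\langle\rho(f_i,f_j)\omega,\rho(hf_i,hf_j)\omega\rangle$.
The square is nonnegative. The double sum is a trace in each index, so it may be computed in a basis
with $he_i=c_ie_{\sigma(i)}$, $|c_i|\le B=|b_m|$. Each term is then at least $-\frac12B^2$ times the
sum of the squared norms of the two rotated forms, and the Casimir identity
$\sum_{i,j}|\rho(e_i,e_j)\omega|^2=2p(q-p)|\omega|^2$ (`sum_formBilin_rot`) gives the bound.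

Equality makes the estimate sharp for every pair $(i,j)$. If some $|c_i|<B$, then
$\rho(e_i,e_j)\omega=0$ for all $j$, which forces $\omega=0$ because $0<p<q$
(`eq_zero_of_rot_eq_zero`). Hence all $|c_i|$ equal $B$. For $m=1$: if $q=3$, the kernel vector has
$c=0$, so $B=0$; if $q=2$ and $B\ne0$, the pair $(i,\sigma(i))$ gives $\rho(e_1,e_2)\omega=0$ and
again $\omega=0$.

Geometry enters only through the skewness of $h$, which is the condition $\mathcal L_\xi g=0$ on
$Q$, and through $\xi\lrcorner\omega=0$, by which $\omega_x$ is determined on $Q_x$. -/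

noncomputable section

namespace RiemannianFlow

/-! ### Wedge, contraction and the scalar product of forms. -/

section Algebra

variable {V : Type*} [NormedAddCommGroup V] [InnerProductSpace ℝ V] {q : ℕ}

/-- The exterior product with a vector, as a bilinear map. -/
def extMul (k : ℕ) : V →ₗ[ℝ] V [⋀^Fin k]→ₗ[ℝ] ℝ →ₗ[ℝ] V [⋀^Fin (k + 1)]→ₗ[ℝ] ℝ :=
  LinearMap.mk₂ ℝ
    (fun X α => AlternatingMap.alternatizeUncurryFin ((innerₗ V X).smulRight α))
    (fun X Y α => by
      rw [← AlternatingMap.alternatizeUncurryFin_add]; congr 1; ext; simp [add_mul])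
    (fun c X α => by
      rw [← AlternatingMap.alternatizeUncurryFin_smul]; congr 1; ext; simp [mul_assoc])
    (fun X α β => by
      rw [← AlternatingMap.alternatizeUncurryFin_add]; congr 1; ext; simp)
    (fun c X α => by
      rw [← AlternatingMap.alternatizeUncurryFin_smul]; congr 1; ext; simp; ring)

/-- The interior product with a vector, as a bilinear map. -/
def intMul (k : ℕ) : V →ₗ[ℝ] V [⋀^Fin (k + 1)]→ₗ[ℝ] ℝ →ₗ[ℝ] V [⋀^Fin k]→ₗ[ℝ] ℝ :=
  LinearMap.mk₂ ℝ (fun X α => α.curryLeft X)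
    (fun _ _ _ => map_add _ _ _) (fun _ _ _ => map_smul _ _ _)
    (fun _ _ _ => rfl) (fun _ _ _ => rfl)

lemma extMul_apply (k : ℕ) (X : V) (α : V [⋀^Fin k]→ₗ[ℝ] ℝ) (v : Fin (k + 1) → V) :
    extMul k X α v =
      ∑ i : Fin (k + 1), (-1 : ℝ) ^ (i : ℕ) * (inner ℝ X (v i) * α (i.removeNth v)) := by
  simp [extMul, AlternatingMap.alternatizeUncurryFin_apply]

lemma intMul_apply (k : ℕ) (X : V) (α : V [⋀^Fin (k + 1)]→ₗ[ℝ] ℝ) (v : Fin k → V) :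
    intMul k X α v = α (Matrix.vecCons X v) := rfl

/-- Allows identities between forms to be proved by induction on the degree: contract both sides and
commute the contraction inwards. -/
lemma ext_intMul {k : ℕ} {α β : V [⋀^Fin (k + 1)]→ₗ[ℝ] ℝ}
    (h : ∀ Z, intMul k Z α = intMul k Z β) : α = β := by
  ext v
  have := congrArg (fun γ => γ (Fin.tail v)) (h (v 0))
  simpa only [intMul_apply, Matrix.vecCons, Fin.cons_self_tail] using this

lemma intMul_intMul (k : ℕ) (X Y : V) (α : V [⋀^Fin (k + 2)]→ₗ[ℝ] ℝ) :
    intMul k X (intMul (k + 1) Y α) = -intMul k Y (intMul (k + 1) X α) := by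
  have h : intMul k (X + Y) (intMul (k + 1) (X + Y) α) = 0 :=
    AlternatingMap.curryLeft_same α (X + Y)
  have hX : intMul k X (intMul (k + 1) X α) = 0 := AlternatingMap.curryLeft_same α X
  have hY : intMul k Y (intMul (k + 1) Y α) = 0 := AlternatingMap.curryLeft_same α Y
  simp only [map_add, LinearMap.add_apply, hX, hY, zero_add, add_zero] at h
  exact eq_neg_of_add_eq_zero_right h

lemma intMul_extMul_zero (X Y : V) (α : V [⋀^Fin 0]→ₗ[ℝ] ℝ) :
    intMul 0 X (extMul 0 Y α) = (inner ℝ X Y : ℝ) • α := by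
  ext v
  rw [intMul_apply, extMul_apply]
  simp [real_inner_comm X Y]

lemma intMul_extMul (k : ℕ) (X Y : V) (α : V [⋀^Fin (k + 1)]→ₗ[ℝ] ℝ) :
    intMul (k + 1) X (extMul (k + 1) Y α) =
      (inner ℝ X Y : ℝ) • α - extMul k Y (intMul k X α) := by
  ext v
  rw [intMul_apply, extMul_apply, Fin.sum_univ_succ, AlternatingMap.sub_apply, extMul_apply,
    sub_eq_add_neg, ← Finset.sum_neg_distrib]
  congr 1
  · simp [real_inner_comm X Y, Matrix.vecCons]
  · refine Finset.sum_congr rfl fun i _ => ?_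
    have : (i.succ).removeNth (Matrix.vecCons X v) = Matrix.vecCons X (i.removeNth v) := by
      funext j
      refine Fin.cases ?_ (fun j => ?_) j
      · simp [Fin.removeNth]
      · simp [Fin.removeNth]
    rw [this, intMul_apply]
    simp [pow_succ]

lemma extMul_extMul (k : ℕ) (X Y : V) (α : V [⋀^Fin k]→ₗ[ℝ] ℝ) :
    extMul (k + 1) X (extMul k Y α) = -extMul (k + 1) Y (extMul k X α) := by
  induction k with
  | zero =>
    refine ext_intMul fun Z => ?_
    rw [map_neg, intMul_extMul, intMul_extMul, intMul_extMul_zero, intMul_extMul_zero]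
    simp only [map_smul]
    abel
  | succ k ih =>
    refine ext_intMul fun Z => ?_
    rw [map_neg, intMul_extMul, intMul_extMul, intMul_extMul, intMul_extMul]
    simp only [map_smul, map_sub]
    rw [ih (intMul k Z α)]
    abel

/-- The infinitesimal rotation `Y ∧ (X ⌟ w) - X ∧ (Y ⌟ w)` of a form of positive degree. -/
def rot (k : ℕ) : V →ₗ[ℝ] V →ₗ[ℝ] V [⋀^Fin (k + 1)]→ₗ[ℝ] ℝ →ₗ[ℝ] V [⋀^Fin (k + 1)]→ₗ[ℝ] ℝ :=
  LinearMap.mk₂ ℝ (fun X Y => extMul k Y ∘ₗ intMul k X - extMul k X ∘ₗ intMul k Y)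
    (fun X Y Z => by ext1 w; simp; abel)
    (fun c X Y => by ext1 w; simp [smul_sub])
    (fun X Y Z => by ext1 w; simp; abel)
    (fun c X Y => by ext1 w; simp [smul_sub])

lemma rot_apply (k : ℕ) (X Y : V) (w : V [⋀^Fin (k + 1)]→ₗ[ℝ] ℝ) :
    rot k X Y w = extMul k Y (intMul k X w) - extMul k X (intMul k Y w) := rfl

lemma rot_swap (k : ℕ) (X Y : V) (w : V [⋀^Fin (k + 1)]→ₗ[ℝ] ℝ) :
    rot k X Y w = -rot k Y X w := by
  simp [rot_apply]

lemma rot_self (k : ℕ) (X : V) (w : V [⋀^Fin (k + 1)]→ₗ[ℝ] ℝ) : rot k X X w = 0 := by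
  simp [rot_apply]

/-! ### Clifford brackets -/

lemma wedge_ofDegree (X : V) {k : ℕ} (α : V [⋀^Fin k]→ₗ[ℝ] ℝ) :
    wedge X (ofDegree α) = ofDegree (extMul k X α) := by
  funext n
  cases n with
  | zero => simp [wedge, ofDegree]
  | succ n =>
    change extMul n X (ofDegree α n) = _
    by_cases h : n = k
    · subst h; simp [ofDegree]
    · simp [ofDegree, h]

lemma contract_ofDegree_succ (X : V) {k : ℕ} (α : V [⋀^Fin (k + 1)]→ₗ[ℝ] ℝ) :
    contract X (ofDegree α) = ofDegree (intMul k X α) := by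
  funext n
  change intMul n X (ofDegree α (n + 1)) = _
  by_cases h : n = k
  · subst h; simp [ofDegree]
  · simp [ofDegree, h]

lemma contract_ofDegree_zero (X : V) (α : V [⋀^Fin 0]→ₗ[ℝ] ℝ) :
    contract X (ofDegree α) = 0 := by
  funext n
  change intMul n X (ofDegree α (n + 1)) = _
  simp [ofDegree]

lemma degreeSign_ofDegree {k : ℕ} (α : V [⋀^Fin k]→ₗ[ℝ] ℝ) :
    degreeSign (ofDegree α) = (-1 : ℝ) ^ k • ofDegree α := by
  funext n
  by_cases h : n = k
  · subst h; rfl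
  · simp [degreeSign, ofDegree, h]

lemma wedge_add (X : V) (α β : MixedForm V) : wedge X (α + β) = wedge X α + wedge X β := by
  funext n
  cases n with
  | zero => simp [wedge]
  | succ n => exact map_add (extMul n X) (α n) (β n)

lemma wedge_sub (X : V) (α β : MixedForm V) : wedge X (α - β) = wedge X α - wedge X β := by
  funext n
  cases n with
  | zero => simp [wedge]
  | succ n => exact map_sub (extMul n X) (α n) (β n)

lemma wedge_smul (X : V) (c : ℝ) (α : MixedForm V) : wedge X (c • α) = c • wedge X α := by
  funext n
  cases n with
  | zero => simp [wedge]
  | succ n => exact map_smul (extMul n X) c (α n)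

lemma contract_add (X : V) (α β : MixedForm V) :
    contract X (α + β) = contract X α + contract X β := rfl

lemma contract_sub (X : V) (α β : MixedForm V) :
    contract X (α - β) = contract X α - contract X β := rfl

lemma contract_smul (X : V) (c : ℝ) (α : MixedForm V) :
    contract X (c • α) = c • contract X α := rfl

lemma degreeSign_add (α β : MixedForm V) :
    degreeSign (α + β) = degreeSign α + degreeSign β := by
  funext n
  simp [degreeSign]

lemma degreeSign_smul (c : ℝ) (α : MixedForm V) :
    degreeSign (c • α) = c • degreeSign α := by
  funext n
  exact smul_comm ((-1 : ℝ) ^ n) c (α n)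

lemma ofDegree_sub {k : ℕ} (α β : V [⋀^Fin k]→ₗ[ℝ] ℝ) :
    ofDegree (α - β) = ofDegree α - ofDegree β :=
  map_sub (LinearMap.single ℝ (fun n => V [⋀^Fin n]→ₗ[ℝ] ℝ) k) α β

lemma ofDegree_smul {k : ℕ} (c : ℝ) (α : V [⋀^Fin k]→ₗ[ℝ] ℝ) :
    ofDegree (c • α) = c • ofDegree α :=
  map_smul (LinearMap.single ℝ (fun n => V [⋀^Fin n]→ₗ[ℝ] ℝ) k) c α

lemma ofDegree_neg {k : ℕ} (α : V [⋀^Fin k]→ₗ[ℝ] ℝ) :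
    ofDegree (-α) = -ofDegree α :=
  map_neg (LinearMap.single ℝ (fun n => V [⋀^Fin n]→ₗ[ℝ] ℝ) k) α

/-- The two right multiplications act in consecutive degrees, so their signs multiply to $-1$. The
parts of degree shifted by $\pm2$ then agree in both products and cancel. In the remaining part the
two terms $\langle X,Y\rangle\omega$ cancel as well, so orthogonality is not needed. -/
lemma cliffordBracket_ofDegree {k : ℕ} (X Y : V) (w : V [⋀^Fin (k + 1)]→ₗ[ℝ] ℝ) :
    cliffordBracket X Y (ofDegree w) = ofDegree ((2 : ℝ) • rot k X Y w) := by
  have hcc : contract X (ofDegree (intMul k Y w)) = -contract Y (ofDegree (intMul k X w)) := by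
    cases k with
    | zero => simp [contract_ofDegree_zero]
    | succ k =>
      rw [contract_ofDegree_succ, contract_ofDegree_succ, intMul_intMul, ofDegree_neg]
  have hww : ofDegree (extMul (k + 2) X (extMul (k + 1) Y w)) =
      -ofDegree (extMul (k + 2) Y (extMul (k + 1) X w)) := by
    rw [extMul_extMul, ofDegree_neg]
  unfold cliffordBracket cliffordLeft cliffordRight
  simp only [degreeSign_ofDegree, degreeSign_add, degreeSign_smul, wedge_ofDegree, wedge_sub,
    wedge_add, wedge_smul, contract_sub, contract_add, contract_smul, contract_ofDegree_succ,
    hcc, hww, intMul_extMul, real_inner_comm X Y, rot_apply, ofDegree_sub, ofDegree_smul]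
  rcases neg_one_pow_eq_or ℝ k with h | h <;> simp only [pow_succ, h] <;> module

/-! ### The scalar product of forms -/

/-- The scalar product of forms as a bilinear map. -/
def formBilin (e : OrthonormalBasis (Fin q) ℝ V) (k : ℕ) :
    V [⋀^Fin k]→ₗ[ℝ] ℝ →ₗ[ℝ] V [⋀^Fin k]→ₗ[ℝ] ℝ →ₗ[ℝ] ℝ :=
  LinearMap.mk₂ ℝ (formInner e)
    (fun α β γ => by simp [formInner, add_mul, Finset.sum_add_distrib, mul_add])
    (fun c α β => by
      simp only [formInner, AlternatingMap.smul_apply, smul_eq_mul, mul_assoc, ← Finset.mul_sum]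
      ring)
    (fun α β γ => by simp [formInner, Finset.sum_add_distrib, mul_add])
    (fun c α β => by
      simp only [formInner, AlternatingMap.smul_apply, smul_eq_mul, mul_left_comm _ c,
        ← Finset.mul_sum])

lemma formBilin_apply (e : OrthonormalBasis (Fin q) ℝ V) {k : ℕ} (α β : V [⋀^Fin k]→ₗ[ℝ] ℝ) :
    formBilin e k α β = formInner e α β := rfl

lemma formBilin_comm (e : OrthonormalBasis (Fin q) ℝ V) {k : ℕ} (α β : V [⋀^Fin k]→ₗ[ℝ] ℝ) :
    formBilin e k α β = formBilin e k β α := by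
  simp only [formBilin_apply, formInner, mul_comm]

lemma formBilin_self_nonneg (e : OrthonormalBasis (Fin q) ℝ V) {k : ℕ}
    (α : V [⋀^Fin k]→ₗ[ℝ] ℝ) : 0 ≤ formBilin e k α α :=
  mul_nonneg (by positivity) (Finset.sum_nonneg fun _ _ => mul_self_nonneg _)

lemma eq_zero_of_formBilin_self (e : OrthonormalBasis (Fin q) ℝ V) {k : ℕ}
    {α : V [⋀^Fin k]→ₗ[ℝ] ℝ} (h : formBilin e k α α = 0) : α = 0 := by
  have h' : ∑ v : Fin k → Fin q, α (fun i => e (v i)) * α (fun i => e (v i)) = 0 :=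
    (mul_eq_zero.1 h).resolve_left (by positivity)
  rw [Finset.sum_eq_zero_iff_of_nonneg fun _ _ => mul_self_nonneg _] at h'
  refine Module.Basis.ext_alternating e.toBasis fun v _ => ?_
  simpa using h' v (Finset.mem_univ v)

/-- Split off the first index of each tuple; the factor is $(k+1)!/k!$. -/
lemma formBilin_succ (e : OrthonormalBasis (Fin q) ℝ V) (k : ℕ)
    (α β : V [⋀^Fin (k + 1)]→ₗ[ℝ] ℝ) :
    ((k : ℝ) + 1) * formBilin e (k + 1) α β =
      ∑ i, formBilin e k (intMul k (e i) α) (intMul k (e i) β) := by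
  simp only [formBilin_apply, formInner, ← Finset.mul_sum, Nat.factorial_succ, intMul_apply]
  have hk : (k.factorial : ℝ) ≠ 0 := by positivity
  have hk' : (k : ℝ) + 1 ≠ 0 := by positivity
  push_cast
  rw [mul_inv, ← mul_assoc, ← mul_assoc, mul_inv_cancel₀ hk', one_mul]
  congr 1
  rw [← (Fin.consEquiv fun _ => Fin q).sum_comp, Fintype.sum_prod_type]
  refine Finset.sum_congr rfl fun i _ => Finset.sum_congr rfl fun v _ => ?_
  have : (fun j => e ((Fin.consEquiv fun _ => Fin q) (i, v) j)) =
      Matrix.vecCons (e i) fun j => e (v j) := by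
    funext j
    refine Fin.cases ?_ (fun j => ?_) j <;> simp [Fin.consEquiv]
  rw [this]

lemma sum_inner_smul_intMul (e : OrthonormalBasis (Fin q) ℝ V) {k : ℕ} (X : V)
    (α : V [⋀^Fin (k + 1)]→ₗ[ℝ] ℝ) :
    ∑ i, (inner ℝ (e i) X : ℝ) • intMul k (e i) α = intMul k X α := by
  conv_rhs => rw [← e.sum_repr' X]
  simp

/-- Exterior and interior product with a vector are adjoint to each other. -/
lemma formBilin_extMul (e : OrthonormalBasis (Fin q) ℝ V) {k : ℕ} (X : V)
    (α : V [⋀^Fin k]→ₗ[ℝ] ℝ) (β : V [⋀^Fin (k + 1)]→ₗ[ℝ] ℝ) :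
    formBilin e (k + 1) (extMul k X α) β = formBilin e k α (intMul k X β) := by
  have hk : (k : ℝ) + 1 ≠ 0 := by positivity
  -- After multiplication by $k+1$, `formBilin_succ` turns the left side into pairings of
  -- contractions, to which the induction hypothesis applies.
  refine mul_left_cancel₀ hk ?_
  rw [formBilin_succ]
  induction k with
  | zero =>
    simp only [intMul_extMul_zero, map_smul, LinearMap.smul_apply]
    rw [← sum_inner_smul_intMul e X β]
    simp
  | succ k ih =>
    have hk' : (k : ℝ) + 1 ≠ 0 := by positivity
    have ih' : ∀ (α : V [⋀^Fin k]→ₗ[ℝ] ℝ) (β : V [⋀^Fin (k + 1)]→ₗ[ℝ] ℝ),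
        formBilin e (k + 1) (extMul k X α) β = formBilin e k α (intMul k X β) := fun α β =>
      mul_left_cancel₀ hk' ((formBilin_succ ..).trans (ih α β hk'))
    simp only [intMul_extMul, map_smul, map_sub, LinearMap.sub_apply, LinearMap.smul_apply, ih',
      intMul_intMul k X, map_neg, sub_neg_eq_add, Finset.sum_add_distrib, ← formBilin_succ]
    have h : ∑ i, (inner ℝ (e i) X : ℝ) • formBilin e (k + 1) α (intMul (k + 1) (e i) β) =
        formBilin e (k + 1) α (intMul (k + 1) X β) := by
      rw [← sum_inner_smul_intMul e X β, map_sum]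
      simp only [map_smul]
    rw [h]
    push_cast
    ring

/-- Antisymmetrising the curried form of `w` returns $k+1$ copies of `w`; expand the curried form in
the basis. -/
lemma sum_extMul_intMul (e : OrthonormalBasis (Fin q) ℝ V) (k : ℕ)
    (w : V [⋀^Fin (k + 1)]→ₗ[ℝ] ℝ) :
    ∑ i, extMul k (e i) (intMul k (e i) w) = ((k : ℝ) + 1) • w := by
  have h := AlternatingMap.alternatizeUncurryFin_curryLeft w
  rw [← Nat.cast_smul_eq_nsmul ℝ] at h
  push_cast at h
  have hw : w.curryLeft = ∑ i, (innerₗ V (e i)).smulRight (intMul k (e i) w) := by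
    ext1 X
    change intMul k X w = _
    simpa using (sum_inner_smul_intMul e X w).symm
  rw [← h, hw, ← AlternatingMap.alternatizeUncurryFinLM_apply, map_sum]
  rfl

end Algebra

/-! ### Traces over rotations and the Bochner operator. -/

section Rotations

variable {V : Type*} [NormedAddCommGroup V] [InnerProductSpace ℝ V] {q : ℕ}

/-- The trace of a bilinear form does not depend on the orthonormal basis. -/
lemma sum_bilin_orthonormalBasis (e f : OrthonormalBasis (Fin q) ℝ V)
    (T : V →ₗ[ℝ] V →ₗ[ℝ] ℝ) : ∑ i, T (e i) (e i) = ∑ i, T (f i) (f i) := by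
  have h : ∀ i, T (e i) (e i) = ∑ j, inner ℝ (f j) (e i) • T (f j) (e i) := fun i => by
    nth_rw 1 [← f.sum_repr' (e i)]
    simp
  simp only [h]
  rw [Finset.sum_comm]
  refine Finset.sum_congr rfl fun j _ => ?_
  have h' : T (f j) (f j) = T (f j) (∑ i, (inner ℝ (e i) (f j) : ℝ) • e i) := by
    rw [e.sum_repr']
  rw [h', map_sum]
  simp [real_inner_comm]

/-- The scalar product remains the one defined by `f`; only the basis of the two traces changes, one
index at a time. No invariance of the scalar product is required. -/
lemma sum_sum_rot (e f : OrthonormalBasis (Fin q) ℝ V) (h : V →ₗ[ℝ] V) {k : ℕ}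
    (w : V [⋀^Fin (k + 1)]→ₗ[ℝ] ℝ) :
    ∑ i, ∑ j, formBilin f (k + 1) (rot k (f i) (f j) w) (rot k (h (f i)) (h (f j)) w) =
      ∑ i, ∑ j, formBilin f (k + 1) (rot k (e i) (e j) w) (rot k (h (e i)) (h (e j)) w) := by
  have key : ∀ X Y : V,
      ∑ j, formBilin f (k + 1) (rot k X (f j) w) (rot k Y (h (f j)) w) =
        ∑ j, formBilin f (k + 1) (rot k X (e j) w) (rot k Y (h (e j)) w) := fun X Y =>
    sum_bilin_orthonormalBasis f e (LinearMap.mk₂ ℝ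
      (fun S T => formBilin f (k + 1) (rot k X S w) (rot k Y (h T) w))
      (by simp) (by simp) (by simp) (by simp))
  simp only [key]
  exact sum_bilin_orthonormalBasis f e (LinearMap.mk₂ ℝ
    (fun S T => ∑ j, formBilin f (k + 1) (rot k S (e j) w) (rot k (h T) (h (e j)) w))
    (by simp [Finset.sum_add_distrib]) (by simp [Finset.mul_sum])
    (by simp [Finset.sum_add_distrib]) (by simp [Finset.mul_sum]))

lemma sum_intMul_extMul (e : OrthonormalBasis (Fin q) ℝ V) (k : ℕ)
    (w : V [⋀^Fin k]→ₗ[ℝ] ℝ) :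
    ∑ i, intMul k (e i) (extMul k (e i) w) = ((q : ℝ) - k) • w := by
  cases k with
  | zero => simp [intMul_extMul_zero, ← Nat.cast_smul_eq_nsmul ℝ]
  | succ k =>
    simp only [intMul_extMul, Finset.sum_sub_distrib, sum_extMul_intMul]
    simp only [orthonormal_iff_ite.1 e.orthonormal, if_true, Finset.sum_const, Finset.card_univ,
      Fintype.card_fin, one_smul, ← Nat.cast_smul_eq_nsmul ℝ]
    push_cast
    module

lemma sum_formBilin_intMul (e f : OrthonormalBasis (Fin q) ℝ V) {k : ℕ}
    (w : V [⋀^Fin (k + 1)]→ₗ[ℝ] ℝ) :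
    ∑ i, formBilin f k (intMul k (e i) w) (intMul k (e i) w) =
      ((k : ℝ) + 1) * formBilin f (k + 1) w w := by
  simp only [← formBilin_extMul, ← LinearMap.sum_apply, ← map_sum, sum_extMul_intMul]
  simp

/-- The Casimir operator of the rotations acts on `p`-forms as `p (q - p)`. -/
lemma sum_formBilin_rot (e f : OrthonormalBasis (Fin q) ℝ V) {k : ℕ}
    (w : V [⋀^Fin (k + 1)]→ₗ[ℝ] ℝ) :
    ∑ i, ∑ j, formBilin f (k + 1) (rot k (e i) (e j) w) (rot k (e i) (e j) w) =
      2 * (((k : ℝ) + 1) * ((q : ℝ) - (k + 1)) * formBilin f (k + 1) w w) := by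
  -- Expanding the square gives two pure sums (`hA`) and two mixed ones (`hB`), and
  -- $2(q-k)(k+1)-2(k+1)=2(k+1)(q-k-1)$.
  have hA : ∑ i, ∑ j, formBilin f (k + 1) (extMul k (e j) (intMul k (e i) w))
      (extMul k (e j) (intMul k (e i) w)) =
        ((q : ℝ) - k) * (((k : ℝ) + 1) * formBilin f (k + 1) w w) := by
    simp only [formBilin_extMul, ← map_sum, sum_intMul_extMul]
    simp only [map_smul, smul_eq_mul, ← Finset.mul_sum, sum_formBilin_intMul]
  have hB : ∑ i, ∑ j, formBilin f (k + 1) (extMul k (e j) (intMul k (e i) w))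
      (extMul k (e i) (intMul k (e j) w)) = ((k : ℝ) + 1) * formBilin f (k + 1) w w := by
    rw [← sum_formBilin_intMul e]
    simp only [formBilin_extMul]
    refine Finset.sum_congr rfl fun i _ => ?_
    cases k with
    | zero =>
      simp [intMul_extMul_zero, orthonormal_iff_ite.1 e.orthonormal, apply_ite]
    | succ k =>
      have : ∀ j, intMul k (e j) (intMul (k + 1) (e j) w) = 0 := fun j =>
        AlternatingMap.curryLeft_same w (e j)
      simp [intMul_extMul, orthonormal_iff_ite.1 e.orthonormal, this, apply_ite]
  have hswap := fun F : Fin q → Fin q → ℝ =>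
    Finset.sum_comm (s := Finset.univ) (t := Finset.univ) (f := F)
  simp only [rot_apply, map_sub, LinearMap.sub_apply, Finset.sum_sub_distrib]
  rw [hA, hB, hswap fun i j => formBilin f (k + 1) (extMul k (e i) (intMul k (e j) w))
      (extMul k (e j) (intMul k (e i) w)), hB,
    hswap fun i j => formBilin f (k + 1) (extMul k (e i) (intMul k (e j) w))
      (extMul k (e i) (intMul k (e j) w)), hA]
  ring

lemma eq_zero_of_extMul_eq_zero (e : OrthonormalBasis (Fin q) ℝ V) {k : ℕ} (hk : k ≠ q)
    {w : V [⋀^Fin k]→ₗ[ℝ] ℝ} (h : ∀ X, extMul k X w = 0) : w = 0 := by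
  have := sum_intMul_extMul e k w
  simp only [h, map_zero, Finset.sum_const_zero] at this
  refine (smul_eq_zero.1 this.symm).resolve_left (sub_ne_zero.2 ?_)
  exact_mod_cast hk.symm

lemma eq_zero_of_intMul_eq_zero {k : ℕ}
    {w : V [⋀^Fin (k + 1)]→ₗ[ℝ] ℝ} (h : ∀ X, intMul k X w = 0) : w = 0 :=
  ext_intMul fun Z => by rw [h, map_zero]

lemma extMul_extMul_self (k : ℕ) (X : V) (w : V [⋀^Fin k]→ₗ[ℝ] ℝ) :
    extMul (k + 1) X (extMul k X w) = 0 :=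
  (smul_eq_zero.1 ((two_smul ℝ _).trans (eq_neg_iff_add_eq_zero.1
    (extMul_extMul k X X w)))).resolve_left two_ne_zero

lemma intMul_extMul_intMul_self (k : ℕ) {X : V} (hX : ‖X‖ = 1) (Y : V)
    (w : V [⋀^Fin (k + 1)]→ₗ[ℝ] ℝ) (hY : extMul k X (intMul k Y w) = 0)
    (h : intMul k X w = 0) : intMul k Y w = 0 := by
  have hXX : (inner ℝ X X : ℝ) = 1 := by rw [real_inner_self_eq_norm_sq, hX, one_pow]
  have := congrArg (intMul k X) hY
  cases k with
  | zero => simpa only [intMul_extMul_zero, hXX, one_smul, map_zero] using this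
  | succ k =>
    rw [intMul_extMul, intMul_intMul, h] at this
    simpa only [hXX, one_smul, map_zero, neg_zero, sub_zero] using this

/-- A form of degree `0 < p < q` that is killed by all rotations in planes containing a fixed
unit vector vanishes. -/
lemma eq_zero_of_rot_eq_zero (e : OrthonormalBasis (Fin q) ℝ V) {k : ℕ} (hk : k + 1 < q)
    {w : V [⋀^Fin (k + 1)]→ₗ[ℝ] ℝ} {X : V} (hX : ‖X‖ = 1) (h : ∀ Y, rot k X Y w = 0) :
    w = 0 := by
  have hXX : (inner ℝ X X : ℝ) = 1 := by rw [real_inner_self_eq_norm_sq, hX, one_pow]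
  have h' : ∀ Y, extMul k Y (intMul k X w) = extMul k X (intMul k Y w) := fun Y =>
    sub_eq_zero.1 (h Y)
  -- For every $Y$, $Y\wedge X\wedge(X\lrcorner w)=-X\wedge Y\wedge(X\lrcorner w)=-X\wedge
  -- X\wedge(Y\lrcorner w)=0$, and below top degree only the zero form is killed by every wedge.
  have hβ : extMul k X (intMul k X w) = 0 := by
    refine eq_zero_of_extMul_eq_zero e hk.ne fun Y => ?_
    rw [extMul_extMul, h', extMul_extMul_self, neg_zero]
  have hX0 : intMul k X w = 0 := by
    have := congrArg (intMul k X) hβ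
    cases k with
    | zero => simpa only [intMul_extMul_zero, hXX, one_smul, map_zero] using this
    | succ k =>
      have h0 : intMul k X (intMul (k + 1) X w) = 0 := AlternatingMap.curryLeft_same w X
      rw [intMul_extMul, h0] at this
      simpa only [hXX, one_smul, map_zero, sub_zero] using this
  refine eq_zero_of_intMul_eq_zero fun Y => intMul_extMul_intMul_self k hX Y w ?_ hX0
  rw [← h', hX0, map_zero]

lemma sum_lt_eq_half (G : Fin q → Fin q → ℝ) (hG : ∀ i j, G i j = G j i) (h0 : ∀ i, G i i = 0) :
    ∑ r : Fin q × Fin q with r.1 < r.2, G r.1 r.2 = (1 / 2) * ∑ i, ∑ j, G i j := by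
  have h1 : ∑ i, ∑ j, G i j = ∑ i, ∑ j, ((if i < j then G i j else 0) +
      (if j < i then G j i else 0)) := by
    refine Finset.sum_congr rfl fun i _ => Finset.sum_congr rfl fun j _ => ?_
    rcases lt_trichotomy i j with h | rfl | h
    · simp [h, h.not_gt]
    · simp [h0]
    · simp [h, h.not_gt, hG i j]
  have h2 : ∑ i, ∑ j, (if j < i then G j i else 0) = ∑ i, ∑ j, (if i < j then G i j else 0) :=
    Finset.sum_comm
  rw [h1, Finset.sum_filter, Fintype.sum_prod_type]
  simp only [Finset.sum_add_distrib, h2]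
  ring

lemma mixedInner_ofDegree (e : OrthonormalBasis (Fin q) ℝ V) {k : ℕ} (hk : k ≤ q)
    (α β : V [⋀^Fin k]→ₗ[ℝ] ℝ) :
    mixedInner e (ofDegree α) (ofDegree β) = formBilin e k α β := by
  unfold mixedInner
  rw [Finset.sum_eq_single k]
  · simp [ofDegree, formBilin_apply]
  · intro n _ hn
    simp [ofDegree, hn, formInner]
  · intro h
    exact absurd (Finset.mem_range.2 (Nat.lt_succ_of_le hk)) h

/-- The exterior part of the Bochner operator, in terms of infinitesimal rotations. -/
lemma bochnerExt_eq (f : OrthonormalBasis (Fin q) ℝ V) {h : V →ₗ[ℝ] V}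
    (hh : ∀ X Y, (inner ℝ (h X) Y : ℝ) = -inner ℝ X (h Y)) {k : ℕ} (hk : k + 1 ≤ q)
    (w : V [⋀^Fin (k + 1)]→ₗ[ℝ] ℝ) :
    bochnerExt f h w w =
      (1 / 2) * formBilin f (k + 1) (∑ i, rot k (f i) (h (f i)) w)
        (∑ i, rot k (f i) (h (f i)) w) +
      (1 / 2) * ∑ i, ∑ j,
        formBilin f (k + 1) (rot k (f i) (f j) w) (rot k (h (f i)) (h (f j)) w) := by
  have hh' : ∀ X Y, (inner ℝ (h X) Y : ℝ) = -inner ℝ (h Y) X := fun X Y => by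
    rw [hh, real_inner_comm]
  have hrep : ∀ X, ∑ l, (inner ℝ X (f l) : ℝ) • f l = X := fun X => by
    simpa [real_inner_comm] using f.sum_repr' X
  have hC1 : ∀ X Y Z W, extCurvature h Y X Z W = -extCurvature h X Y Z W := fun X Y Z W => by
    simp only [extCurvature, hh' Y X, hh' Z Y, hh' Z X]; ring
  have hC2 : ∀ X Y Z W, extCurvature h X Y W Z = -extCurvature h X Y Z W := fun X Y Z W => by
    simp only [extCurvature, hh' Z W, hh' W X, hh' Z X]; ring
  -- Contracting the curvature with the rotations: the last two curvature terms each contribute `rot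
  -- k (h X) (h Y) w`, the third by skewness of `h` and the second by antisymmetry of `rot`.
  have hsum : ∀ X Y : V, ∑ k', ∑ l, extCurvature h X Y (f k') (f l) • rot k (f k') (f l) w =
      (2 * inner ℝ (h X) Y) • ∑ i, rot k (f i) (h (f i)) w + (2 : ℝ) • rot k (h X) (h Y) w := by
    intro X Y
    have e1 : ∀ Z, ∑ l, (inner ℝ (h Z) (f l) : ℝ) • rot k Z (f l) w = rot k Z (h Z) w :=
      fun Z => by
        conv_rhs => rw [← hrep (h Z)]
        simp
    have e2 : ∀ Z W : V, ∑ k', ∑ l, ((inner ℝ Z (f k') : ℝ) * inner ℝ W (f l)) •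
        rot k (f k') (f l) w = rot k Z W w := fun Z W => by
      conv_rhs => rw [← hrep Z, ← hrep W]
      simp only [map_sum, map_smul, LinearMap.sum_apply, LinearMap.smul_apply, Finset.smul_sum,
        smul_smul]
      rw [Finset.sum_comm]
      simp only [mul_comm]
    have e3 : ∀ k' l, extCurvature h X Y (f k') (f l) • rot k (f k') (f l) w =
        (2 * inner ℝ (h X) Y) • ((inner ℝ (h (f k')) (f l) : ℝ) • rot k (f k') (f l) w) -
        ((inner ℝ (h Y) (f k') : ℝ) * inner ℝ (h X) (f l)) • rot k (f k') (f l) w +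
        ((inner ℝ (h X) (f k') : ℝ) * inner ℝ (h Y) (f l)) • rot k (f k') (f l) w :=
      fun k' l => by
        rw [extCurvature, hh' (f k') X]
        module
    simp only [e3, Finset.sum_add_distrib, Finset.sum_sub_distrib, ← Finset.smul_sum, e1, e2]
    rw [rot_swap k (h Y)]
    module
  -- The factor 4 from the two Clifford brackets cancels the two halves from replacing $i<j$, $k<l$
  -- by unrestricted sums.
  have hfull : bochnerExt f h w w = (1 / 4) * ∑ i, ∑ j, ∑ k', ∑ l,
      extCurvature h (f i) (f j) (f k') (f l) *
        formBilin f (k + 1) (rot k (f i) (f j) w) (rot k (f k') (f l) w) := by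
    unfold bochnerExt
    simp only [cliffordBracket_ofDegree, mixedInner_ofDegree f hk]
    have inner_sum : ∀ i j, ∑ s : Fin q × Fin q with s.1 < s.2,
        extCurvature h (f i) (f j) (f s.1) (f s.2) *
          formBilin f (k + 1) ((2 : ℝ) • rot k (f i) (f j) w)
            ((2 : ℝ) • rot k (f s.1) (f s.2) w) = 2 * ∑ k', ∑ l,
        extCurvature h (f i) (f j) (f k') (f l) *
          formBilin f (k + 1) (rot k (f i) (f j) w) (rot k (f k') (f l) w) := by
      intro i j
      rw [sum_lt_eq_half (fun s t => extCurvature h (f i) (f j) (f s) (f t) *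
          formBilin f (k + 1) ((2 : ℝ) • rot k (f i) (f j) w)
            ((2 : ℝ) • rot k (f s) (f t) w))]
      · simp only [Finset.mul_sum, map_smul, LinearMap.smul_apply, smul_eq_mul]
        refine Finset.sum_congr rfl fun _ _ => Finset.sum_congr rfl fun _ _ => ?_
        ring
      · intro s t
        rw [hC2, rot_swap k (f s)]
        simp
      · intro s
        simp [rot_self]
    simp only [inner_sum]
    rw [sum_lt_eq_half (fun i j => 2 * ∑ k', ∑ l, extCurvature h (f i) (f j) (f k') (f l) *
          formBilin f (k + 1) (rot k (f i) (f j) w) (rot k (f k') (f l) w))]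
    · simp only [← Finset.mul_sum]
      ring
    · intro i j
      simp only [hC1 (f j) (f i), rot_swap k (f i) (f j)]
      simp
    · intro i
      simp [rot_self]
  have e6 : ∀ i j, ∑ k', ∑ l, extCurvature h (f i) (f j) (f k') (f l) *
      formBilin f (k + 1) (rot k (f i) (f j) w) (rot k (f k') (f l) w) =
      formBilin f (k + 1) (rot k (f i) (f j) w) ((2 * inner ℝ (h (f i)) (f j)) •
        ∑ i, rot k (f i) (h (f i)) w + (2 : ℝ) • rot k (h (f i)) (h (f j)) w) := fun i j => by
    rw [← hsum]
    simp only [map_sum, map_smul, smul_eq_mul]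
  simp only [hfull, e6]
  have e4 : ∀ i, ∑ j, (inner ℝ (h (f i)) (f j) : ℝ) • rot k (f i) (f j) w =
      rot k (f i) (h (f i)) w := fun i => by
    conv_rhs => rw [← hrep (h (f i))]
    simp
  simp only [map_add, map_smul, smul_eq_mul, Finset.sum_add_distrib]
  have e5 : ∀ γ, ∑ i, ∑ j, 2 * inner ℝ (h (f i)) (f j) *
      formBilin f (k + 1) (rot k (f i) (f j) w) γ =
      2 * formBilin f (k + 1) (∑ i, rot k (f i) (h (f i)) w) γ := fun γ => by
    simp only [← e4, map_sum, LinearMap.sum_apply, map_smul, LinearMap.smul_apply, smul_eq_mul,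
      Finset.mul_sum, mul_assoc]
  rw [e5]
  simp only [← Finset.mul_sum]
  ring

end Rotations

/-! ### The lower bound and the case of equality. -/

section Estimate

variable {V : Type*} [NormedAddCommGroup V] [InnerProductSpace ℝ V] {q : ℕ}

lemma abs_formBilin_le (f : OrthonormalBasis (Fin q) ℝ V) {k : ℕ} (α β : V [⋀^Fin k]→ₗ[ℝ] ℝ) :
    |formBilin f k α β| ≤ (formBilin f k α α + formBilin f k β β) / 2 := by
  have h1 := formBilin_self_nonneg f (α + β)
  have h2 := formBilin_self_nonneg f (α - β)
  simp only [map_add, map_sub, LinearMap.add_apply, LinearMap.sub_apply,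
    formBilin_comm f β α] at h1 h2
  rw [abs_le]
  constructor <;> linarith

/-- The defect, in the plane spanned by `e i` and `e j`, of the estimate of the Bochner operator
for `h (e i) = c i • e (σ i)`. -/
def planeDefect (e f : OrthonormalBasis (Fin q) ℝ V) (σ : Fin q → Fin q) (c : Fin q → ℝ) (B : ℝ)
    {k : ℕ} (w : V [⋀^Fin (k + 1)]→ₗ[ℝ] ℝ) (i j : Fin q) : ℝ :=
  c i * c j * formBilin f (k + 1) (rot k (e i) (e j) w) (rot k (e (σ i)) (e (σ j)) w) +
    B ^ 2 / 2 * (formBilin f (k + 1) (rot k (e i) (e j) w) (rot k (e i) (e j) w) +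
      formBilin f (k + 1) (rot k (e (σ i)) (e (σ j)) w) (rot k (e (σ i)) (e (σ j)) w))

lemma le_planeDefect (e f : OrthonormalBasis (Fin q) ℝ V) (σ : Fin q → Fin q) (c : Fin q → ℝ)
    (B : ℝ) {k : ℕ} (w : V [⋀^Fin (k + 1)]→ₗ[ℝ] ℝ) (i j : Fin q) :
    (B ^ 2 - |c i| * |c j|) / 2 *
      (formBilin f (k + 1) (rot k (e i) (e j) w) (rot k (e i) (e j) w) +
        formBilin f (k + 1) (rot k (e (σ i)) (e (σ j)) w) (rot k (e (σ i)) (e (σ j)) w)) ≤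
      planeDefect e f σ c B w i j := by
  have h := abs_formBilin_le f (rot k (e i) (e j) w) (rot k (e (σ i)) (e (σ j)) w)
  have h1 := mul_le_mul_of_nonneg_left h (abs_nonneg (c i * c j))
  rw [← abs_mul] at h1
  have h2 := neg_abs_le (c i * c j *
    formBilin f (k + 1) (rot k (e i) (e j) w) (rot k (e (σ i)) (e (σ j)) w))
  unfold planeDefect
  rw [abs_mul (c i) (c j)] at h1
  linarith

section

variable {e f : OrthonormalBasis (Fin q) ℝ V} {σ : Fin q → Fin q} {c : Fin q → ℝ} {B : ℝ}
  {k : ℕ} {w : V [⋀^Fin (k + 1)]→ₗ[ℝ] ℝ} {h : V →ₗ[ℝ] V}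

lemma planeDefect_nonneg (hB : ∀ i, |c i| ≤ B) (i j : Fin q) :
    0 ≤ planeDefect e f σ c B w i j := by
  refine le_trans (mul_nonneg ?_ (add_nonneg (formBilin_self_nonneg _ _)
    (formBilin_self_nonneg _ _))) (le_planeDefect e f σ c B w i j)
  have := mul_le_mul (hB i) (hB j) (abs_nonneg _) ((abs_nonneg _).trans (hB i))
  nlinarith

/-- Since `σ` permutes the basis, both squared norms in `planeDefect` have the same double sum, and
the Casimir identity evaluates it. The gap in the inequality is thus a sum of nonnegative terms. -/
lemma bochnerExt_add_eq (hh : ∀ X Y, (inner ℝ (h X) Y : ℝ) = -inner ℝ X (h Y))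
    (hσ : Function.Involutive σ) (hc : ∀ i, h (e i) = c i • e (σ i)) (hk : k + 1 ≤ q) :
    bochnerExt f h w w + ((k : ℝ) + 1) * ((q : ℝ) - (k + 1)) * B ^ 2 * formBilin f (k + 1) w w =
      (1 / 2) * formBilin f (k + 1) (∑ i, rot k (f i) (h (f i)) w)
        (∑ i, rot k (f i) (h (f i)) w) +
      (1 / 2) * ∑ i, ∑ j, planeDefect e f σ c B w i j := by
  have hperm : ∑ i, ∑ j, formBilin f (k + 1) (rot k (e (σ i)) (e (σ j)) w)
      (rot k (e (σ i)) (e (σ j)) w) =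
      ∑ i, ∑ j, formBilin f (k + 1) (rot k (e i) (e j) w) (rot k (e i) (e j) w) := by
    rw [← Equiv.sum_comp hσ.toPerm]
    refine Finset.sum_congr rfl fun i _ => ?_
    rw [← Equiv.sum_comp hσ.toPerm]
    have hσσ : ∀ x, σ (σ x) = x := hσ
    simp [hσ.coe_toPerm, hσσ]
  have hS : ∑ i, ∑ j, formBilin f (k + 1) (rot k (e i) (e j) w)
      (rot k (h (e i)) (h (e j)) w) = ∑ i, ∑ j, c i * c j *
        formBilin f (k + 1) (rot k (e i) (e j) w) (rot k (e (σ i)) (e (σ j)) w) := by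
    refine Finset.sum_congr rfl fun i _ => Finset.sum_congr rfl fun j _ => ?_
    simp only [hc, map_smul, LinearMap.smul_apply, smul_eq_mul]
    ring
  rw [bochnerExt_eq f hh hk, sum_sum_rot e f h w, hS]
  simp only [planeDefect, Finset.sum_add_distrib, ← Finset.mul_sum, hperm, sum_formBilin_rot]
  ring

lemma neg_le_bochnerExt (hh : ∀ X Y, (inner ℝ (h X) Y : ℝ) = -inner ℝ X (h Y))
    (hσ : Function.Involutive σ) (hc : ∀ i, h (e i) = c i • e (σ i)) (hB : ∀ i, |c i| ≤ B)
    (hk : k + 1 ≤ q) :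
    -(((k : ℝ) + 1) * ((q : ℝ) - (k + 1)) * B ^ 2 * formBilin f (k + 1) w w) ≤
      bochnerExt f h w w := by
  have h1 := bochnerExt_add_eq (f := f) (w := w) (B := B) hh hσ hc hk
  have h2 := formBilin_self_nonneg f (∑ i, rot k (f i) (h (f i)) w)
  have h3 : 0 ≤ ∑ i, ∑ j, planeDefect e f σ c B w i j :=
    Finset.sum_nonneg fun i _ => Finset.sum_nonneg fun j _ => planeDefect_nonneg hB i j
  linarith

lemma planeDefect_eq_zero (hh : ∀ X Y, (inner ℝ (h X) Y : ℝ) = -inner ℝ X (h Y))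
    (hσ : Function.Involutive σ) (hc : ∀ i, h (e i) = c i • e (σ i)) (hB : ∀ i, |c i| ≤ B)
    (hk : k + 1 ≤ q) (heq : bochnerExt f h w w =
      -(((k : ℝ) + 1) * ((q : ℝ) - (k + 1)) * B ^ 2 * formBilin f (k + 1) w w))
    (i j : Fin q) : planeDefect e f σ c B w i j = 0 := by
  have h1 := bochnerExt_add_eq (f := f) (w := w) (B := B) hh hσ hc hk
  have h2 := formBilin_self_nonneg f (∑ i, rot k (f i) (h (f i)) w)
  have h4 : ∀ i, 0 ≤ ∑ j, planeDefect e f σ c B w i j := fun i =>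
    Finset.sum_nonneg fun j _ => planeDefect_nonneg hB i j
  have h3 : ∑ i, ∑ j, planeDefect e f σ c B w i j = 0 :=
    le_antisymm (by linarith) (Finset.sum_nonneg fun i _ => h4 i)
  rw [Finset.sum_eq_zero_iff_of_nonneg fun i _ => h4 i] at h3
  have h5 := h3 i (Finset.mem_univ i)
  rw [Finset.sum_eq_zero_iff_of_nonneg fun j _ => planeDefect_nonneg hB i j] at h5
  exact h5 j (Finset.mem_univ j)

lemma eq_zero_of_rot_basis_eq_zero (hk : k + 1 < q) (i : Fin q)
    (hi : ∀ j, rot k (e i) (e j) w = 0) : w = 0 := by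
  refine eq_zero_of_rot_eq_zero e hk (e.orthonormal.1 i) fun Y => ?_
  rw [← e.sum_repr' Y]
  simp [hi]

/-- In the case of equality, all the skew-eigenvalues have the same absolute value. -/
lemma abs_eq_of_bochnerExt_eq (hh : ∀ X Y, (inner ℝ (h X) Y : ℝ) = -inner ℝ X (h Y))
    (hσ : Function.Involutive σ) (hc : ∀ i, h (e i) = c i • e (σ i)) (hB : ∀ i, |c i| ≤ B)
    (hk : k + 1 < q) (heq : bochnerExt f h w w =
      -(((k : ℝ) + 1) * ((q : ℝ) - (k + 1)) * B ^ 2 * formBilin f (k + 1) w w))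
    (hw : w ≠ 0) (i : Fin q) : |c i| = B := by
  by_contra hne
  have hlt : |c i| < B := lt_of_le_of_ne (hB i) hne
  refine hw (eq_zero_of_rot_basis_eq_zero (e := e) hk i fun j => eq_zero_of_formBilin_self f ?_)
  have h1 := le_planeDefect e f σ c B w i j
  rw [planeDefect_eq_zero hh hσ hc hB hk.le heq] at h1
  -- Strict for every `j`, even where $|c_j|=B$, because $|c_i|<B$ and $B>0$.
  have hpos : 0 < (B ^ 2 - |c i| * |c j|) / 2 := by
    have := mul_le_mul_of_nonneg_left (hB j) (abs_nonneg (c i))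
    have := mul_lt_mul_of_pos_right hlt ((abs_nonneg _).trans_lt hlt)
    nlinarith
  have h2 := formBilin_self_nonneg f (rot k (e i) (e j) w)
  have h3 := formBilin_self_nonneg f (rot k (e (σ i)) (e (σ j)) w)
  have h4 := nonpos_of_mul_nonpos_right h1 hpos
  linarith

/-- For `j = σ i` skewness gives $c_{\sigma(i)}=-c_i$, and `rot` also changes sign, so the cross
term is $+c_i^2$ times the squared norm: the defect equals
$(c_i^2+B^2)|\rho(e_i,e_{\sigma(i)})w|^2$. -/
lemma rot_partner_eq_zero (hh : ∀ X Y, (inner ℝ (h X) Y : ℝ) = -inner ℝ X (h Y))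
    (hσ : Function.Involutive σ) (hc : ∀ i, h (e i) = c i • e (σ i)) (hB : ∀ i, |c i| ≤ B)
    (hB0 : B ≠ 0) (hk : k + 1 ≤ q) (heq : bochnerExt f h w w =
      -(((k : ℝ) + 1) * ((q : ℝ) - (k + 1)) * B ^ 2 * formBilin f (k + 1) w w))
    (i : Fin q) : rot k (e i) (e (σ i)) w = 0 := by
  have hcσ : c (σ i) = -c i := by
    have := hh (e i) (e (σ i))
    simp only [hc, hσ i, inner_smul_left, inner_smul_right, real_inner_self_eq_norm_sq,
      e.orthonormal.1] at this
    simp at this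
    linarith
  have h0 := planeDefect_eq_zero hh hσ hc hB hk heq i (σ i)
  unfold planeDefect at h0
  rw [hσ i, hcσ, rot_swap k (e (σ i)) (e i)] at h0
  simp only [map_neg, LinearMap.neg_apply, neg_neg] at h0
  refine eq_zero_of_formBilin_self f ?_
  have : (c i ^ 2 + B ^ 2) *
      formBilin f (k + 1) (rot k (e i) (e (σ i)) w) (rot k (e i) (e (σ i)) w) = 0 := by
    linear_combination h0
  exact (mul_eq_zero.1 this).resolve_left (by positivity)

end

lemma IsSkewNormalForm.exists_involution {h : V →ₗ[ℝ] V} {e : OrthonormalBasis (Fin q) ℝ V}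
    {b : Fin (q / 2) → ℝ} (he : IsSkewNormalForm h e b) :
    ∃ (σ : Fin q → Fin q) (c : Fin q → ℝ), Function.Involutive σ ∧
      (∀ i, h (e i) = c i • e (σ i)) ∧
      (∀ i : Fin (q / 2), c ⟨2 * (i : ℕ), by omega⟩ = b i) ∧
      (∀ i : Fin (q / 2), σ ⟨2 * (i : ℕ), by omega⟩ = ⟨2 * (i : ℕ) + 1, by omega⟩) ∧
      (∀ j : Fin q, 2 * (q / 2) ≤ (j : ℕ) → c j = 0) ∧
      ∀ j, c j = 0 ∨ ∃ i, |c j| = |b i| := by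
  classical
  -- `σ` swaps $2i$ and $2i+1$, with coefficient $b_i$ at the even index and $-b_i$ at the odd one;
  -- a leftover last index is fixed, with coefficient 0.
  refine ⟨fun j => if hj : (j : ℕ) < 2 * (q / 2) then
      if h2 : (j : ℕ) % 2 = 0 then ⟨(j : ℕ) + 1, by omega⟩ else ⟨(j : ℕ) - 1, by omega⟩ else j,
    fun j => if hj : (j : ℕ) < 2 * (q / 2) then
      if (j : ℕ) % 2 = 0 then b ⟨j / 2, by omega⟩ else -b ⟨j / 2, by omega⟩ else 0,
    ?_, ?_, ?_, ?_, ?_, ?_⟩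
  · intro j
    ext
    by_cases hj : (j : ℕ) < 2 * (q / 2)
    · by_cases h2 : (j : ℕ) % 2 = 0
      · have h3 : (j : ℕ) + 1 < 2 * (q / 2) := by omega
        have h4 : ((j : ℕ) + 1) % 2 ≠ 0 := by omega
        simp [hj, h2, h3, h4]
      · have h3 : (j : ℕ) - 1 < 2 * (q / 2) := by omega
        have h4 : ((j : ℕ) - 1) % 2 = 0 := by omega
        simp only [hj, h2, h3, h4, dite_true, dite_false]
        omega
    · simp [hj]
  · intro j
    by_cases hj : (j : ℕ) < 2 * (q / 2)
    · by_cases h2 : (j : ℕ) % 2 = 0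
      · have := he.map_fst ⟨j / 2, by omega⟩
        have h3 : 2 * ((j : ℕ) / 2) = j := by omega
        simpa [hj, h2, h3] using this
      · have := he.map_snd ⟨j / 2, by omega⟩
        have h3 : 2 * ((j : ℕ) / 2) = j - 1 := by omega
        have h4 : (j : ℕ) - 1 + 1 = j := by omega
        simpa [hj, h2, h3, h4] using this
    · simpa [hj] using he.map_rest j (not_lt.1 hj)
  · intro i
    have : 2 * (i : ℕ) < 2 * (q / 2) := by omega
    simp [this]
  · intro i
    have : 2 * (i : ℕ) < 2 * (q / 2) := by omega
    simp [this]
  · intro j hj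
    simp [not_lt.2 hj]
  · intro j
    by_cases hj : (j : ℕ) < 2 * (q / 2)
    · refine Or.inr ⟨⟨j / 2, by omega⟩, ?_⟩
      by_cases h2 : (j : ℕ) % 2 = 0 <;> simp [hj, h2]
    · simp [hj]

/-- The pointwise estimate of the exterior part of the Bochner operator, with the case of
equality. -/
lemma IsSkewNormalForm.bochnerExt_estimate {h : V →ₗ[ℝ] V}
    (hh : ∀ X Y, (inner ℝ (h X) Y : ℝ) = -inner ℝ X (h Y)) {e : OrthonormalBasis (Fin q) ℝ V}
    (f : OrthonormalBasis (Fin q) ℝ V) {b : Fin (q / 2) → ℝ} (he : IsSkewNormalForm h e b)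
    {l : Fin (q / 2)} (hl : ∀ i, i ≤ l) {p : ℕ} (hp : 1 ≤ p) (hpq : p ≤ q - 1)
    (w : V [⋀^Fin p]→ₗ[ℝ] ℝ) :
    -((p : ℝ) * ((q : ℝ) - p) * b l ^ 2 * formInner f w w) ≤
        bochnerExt f h w w ∧
      (w ≠ 0 → bochnerExt f h w w =
          -((p : ℝ) * ((q : ℝ) - p) * b l ^ 2 * formInner f w w) →
        (∀ i j, |b i| = |b j|) ∧ (q / 2 = 1 → ∀ i, b i = 0)) := by
  obtain ⟨k, rfl⟩ : ∃ k, p = k + 1 := ⟨p - 1, by omega⟩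
  obtain ⟨σ, c, hσ, hc, hcb, hσe, hrest, hcb'⟩ := he.exists_involution
  have hk : k + 1 < q := by omega
  have hbl : ∀ i, |b i| ≤ |b l| := fun i => he.abs_mono i l (hl i)
  have hB : ∀ i, |c i| ≤ |b l| := fun i => by
    rcases hcb' i with h0 | ⟨j, hj⟩
    · rw [h0, abs_zero]; exact abs_nonneg _
    · rw [hj]; exact hbl j
  rw [← formBilin_apply, ← sq_abs (b l)]
  push_cast
  refine ⟨neg_le_bochnerExt hh hσ hc hB hk.le, fun hw heq => ?_⟩
  have habs := abs_eq_of_bochnerExt_eq hh hσ hc hB hk heq hw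
  refine ⟨fun i j => ?_, fun hq i => ?_⟩
  · rw [← hcb, ← hcb, habs, habs]
  · suffices |b l| = 0 from abs_eq_zero.1 (le_antisymm ((hbl i).trans this.le) (abs_nonneg _))
    by_contra hB0
    have hl0 : (l : ℕ) = 0 := by omega
    have hrot := rot_partner_eq_zero hh hσ hc hB hB0 hk.le heq ⟨2 * (l : ℕ), by omega⟩
    rw [hσe] at hrot
    -- For $q=2$ the only rotation is the one in the plane of the pair; otherwise $q=3$, and index 2
    -- lies in the kernel of `h`.
    rcases (by omega : q = 2 ∨ 2 < q) with rfl | hq3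
    · refine hw (eq_zero_of_rot_basis_eq_zero (e := e) hk ⟨2 * (l : ℕ), by omega⟩ fun j => ?_)
      have hj : j = ⟨2 * (l : ℕ), by omega⟩ ∨ j = ⟨2 * (l : ℕ) + 1, by omega⟩ := by
        simp only [Fin.ext_iff]
        omega
      rcases hj with rfl | rfl
      · exact rot_self _ _ _
      · exact hrot
    · have := habs ⟨2, hq3⟩
      rw [hrest ⟨2, hq3⟩ (by simp [hq]), abs_zero] at this
      exact hB0 this.symm

end Estimate

/-! ### Existence of the skew normal form. -/

section NormalForm

universe u

variable {V : Type u} [NormedAddCommGroup V] [InnerProductSpace ℝ V]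

lemma inner_map_self_eq_zero {h : V →ₗ[ℝ] V}
    (hh : ∀ X Y, (inner ℝ (h X) Y : ℝ) = -inner ℝ X (h Y)) (X : V) :
    (inner ℝ (h X) X : ℝ) = 0 := by
  have := hh X X
  rw [real_inner_comm] at this
  rw [real_inner_comm]
  linarith

lemma eq_zero_of_skew_of_finrank_le_one [FiniteDimensional ℝ V] {h : V →ₗ[ℝ] V}
    (hh : ∀ X Y, (inner ℝ (h X) Y : ℝ) = -inner ℝ X (h Y)) (hV : Module.finrank ℝ V ≤ 1) :
    h = 0 := by
  obtain ⟨v, hv⟩ := finrank_le_one_iff.1 hV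
  ext1 X
  obtain ⟨a, ha⟩ := hv (h X)
  obtain ⟨d, rfl⟩ := hv X
  rw [LinearMap.zero_apply, ← inner_self_eq_zero (𝕜 := ℝ)]
  nth_rw 2 [← ha]
  rw [map_smul, inner_smul_left, inner_smul_right, inner_map_self_eq_zero hh, mul_zero, mul_zero]

/-- A nonzero skew-symmetric endomorphism rotates some plane. -/
lemma exists_rotated_plane [FiniteDimensional ℝ V] {h : V →ₗ[ℝ] V}
    (hh : ∀ X Y, (inner ℝ (h X) Y : ℝ) = -inner ℝ X (h Y)) (h0 : h ≠ 0) :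
    ∃ (u v : V) (b : ℝ), Orthonormal ℝ ![u, v] ∧ h u = b • v ∧ h v = -(b • u) := by
  -- The square of a skew map is symmetric, hence diagonalisable. A unit eigenvector not killed by
  -- `h` spans the plane together with its image, and its eigenvalue is $-\|h(E_i)\|^2$.
  have hS : (h ∘ₗ h).IsSymmetric := fun X Y => by
    simp only [LinearMap.comp_apply]
    rw [hh, hh, neg_neg]
  set E := hS.eigenvectorBasis rfl
  obtain ⟨i, hi⟩ : ∃ i, h (E i) ≠ 0 := by
    by_contra! hcon
    exact h0 (E.toBasis.ext fun i => by simpa using hcon i)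
  have hE : ‖E i‖ = 1 := E.orthonormal.1 i
  have hbpos : ‖h (E i)‖ ≠ 0 := norm_ne_zero_iff.2 hi
  obtain ⟨l, hl⟩ : ∃ l : ℝ, h (h (E i)) = l • E i := ⟨_, hS.apply_eigenvectorBasis rfl i⟩
  have hlb : l = -‖h (E i)‖ ^ 2 := by
    have h1 : (inner ℝ (h (h (E i))) (E i) : ℝ) = l := by
      rw [hl, inner_smul_left, real_inner_self_eq_norm_sq, hE]; simp
    rw [← h1, hh, real_inner_self_eq_norm_sq]
  refine ⟨E i, ‖h (E i)‖⁻¹ • h (E i), ‖h (E i)‖, ?_, ?_, ?_⟩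
  · rw [orthonormal_vecCons_iff]
    refine ⟨hE, fun j => ?_, ?_⟩
    · fin_cases j
      have : (inner ℝ (E i) (h (E i)) : ℝ) = 0 := by
        rw [real_inner_comm, inner_map_self_eq_zero hh]
      simp [inner_smul_right, this]
    · rw [orthonormal_vecCons_iff]
      refine ⟨?_, fun j => j.elim0, ⟨fun j => j.elim0, fun j => j.elim0⟩⟩
      rw [norm_smul, norm_inv, norm_norm, inv_mul_cancel₀ hbpos]
  · rw [smul_smul, mul_inv_cancel₀ hbpos, one_smul]
  · rw [map_smul, hl, hlb, smul_smul, ← neg_smul]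
    congr 1
    field_simp

/-- Split off a rotated plane; its orthogonal complement is invariant by skewness and has dimension
smaller by 2. The space is quantified inside the induction because the step passes to this
complement. -/
lemma exists_skew_families (m r : ℕ) (hr : r < 2) :
    ∀ (V : Type u) [NormedAddCommGroup V] [InnerProductSpace ℝ V] [FiniteDimensional ℝ V]
      (h : V →ₗ[ℝ] V), (∀ X Y, (inner ℝ (h X) Y : ℝ) = -inner ℝ X (h Y)) →
      Module.finrank ℝ V = 2 * m + r →
      ∃ (u v : Fin m → V) (z : Fin r → V) (b : Fin m → ℝ),
        Orthonormal ℝ (Sum.elim (Sum.elim u v) z) ∧ (∀ i, h (u i) = b i • v i) ∧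
        (∀ i, h (v i) = -(b i • u i)) ∧ ∀ j, h (z j) = 0 := by
  induction m with
  | zero =>
    intro V _ _ _ h hh hV
    have h0 := eq_zero_of_skew_of_finrank_le_one hh (by omega)
    let g := (stdOrthonormalBasis ℝ V).reindex (finCongr (hV.trans (by omega) : _ = r))
    refine ⟨fun i => i.elim0, fun i => i.elim0, g, fun i => i.elim0, ?_, fun i => i.elim0,
      fun i => i.elim0, by simp [h0]⟩
    rw [orthonormal_iff_ite]
    rintro ((i | i) | i) ((j | j) | j)
    all_goals first
      | exact i.elim0
      | exact j.elim0
      | simp [orthonormal_iff_ite.1 g.orthonormal]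
  | succ m ih =>
    intro V _ _ _ h hh hV
    by_cases h0 : h = 0
    · let g := (stdOrthonormalBasis ℝ V).reindex (Fintype.equivOfCardEq
        (by simp [hV]; omega) : _ ≃ (Fin (m + 1) ⊕ Fin (m + 1)) ⊕ Fin r)
      refine ⟨fun i => g (.inl (.inl i)), fun i => g (.inl (.inr i)), fun i => g (.inr i), 0, ?_,
        by simp [h0], by simp [h0], by simp [h0]⟩
      convert g.orthonormal using 1
      funext i
      rcases i with (i | i) | i <;> rfl
    · obtain ⟨u₀, v₀, b₀, ho, hu₀, hv₀⟩ := exists_rotated_plane hh h0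
      set W := (Submodule.span ℝ (Set.range ![u₀, v₀]))ᗮ with hWdef
      have hW : ∀ x, x ∈ W ↔ inner ℝ u₀ x = (0 : ℝ) ∧ inner ℝ v₀ x = (0 : ℝ) := fun x => by
        rw [hWdef, Submodule.mem_orthogonal]
        refine ⟨fun H => ⟨H _ (Submodule.subset_span ⟨0, rfl⟩),
          H _ (Submodule.subset_span ⟨1, rfl⟩)⟩, fun H y hy => ?_⟩
        induction hy using Submodule.span_induction with
        | mem y hy =>
          obtain ⟨j, rfl⟩ := hy
          fin_cases j
          exacts [H.1, H.2]
        | zero => simp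
        | add y z _ _ hy hz => rw [inner_add_left, hy, hz, add_zero]
        | smul a y _ hy => rw [inner_smul_left, hy, mul_zero]
      have hWh : ∀ x ∈ W, h x ∈ W := fun x hx => by
        rw [hW] at hx ⊢
        constructor
        · rw [← neg_eq_iff_eq_neg.2 (hh u₀ x), hu₀, inner_smul_left, hx.2, mul_zero, neg_zero]
        · rw [← neg_eq_iff_eq_neg.2 (hh v₀ x), hv₀, inner_neg_left, inner_smul_left, hx.1,
            mul_zero, neg_zero, neg_zero]
      have hWd : Module.finrank ℝ W = 2 * m + r := by
        have h1 := Submodule.finrank_add_finrank_orthogonal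
          (Submodule.span ℝ (Set.range ![u₀, v₀]))
        rw [finrank_span_eq_card ho.linearIndependent, Fintype.card_fin, hV] at h1
        rw [hWdef]
        omega
      obtain ⟨u, v, z, b, hor, hu, hv, hz⟩ := ih W (h.restrict hWh)
        (fun X Y => by simpa using hh X Y) hWd
      rw [orthonormal_iff_ite] at hor ho
      have huu := fun i j => hor (.inl (.inl i)) (.inl (.inl j))
      have huv := fun i j => hor (.inl (.inl i)) (.inl (.inr j))
      have huz := fun i j => hor (.inl (.inl i)) (.inr j)
      have hvu := fun i j => hor (.inl (.inr i)) (.inl (.inl j))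
      have hvv := fun i j => hor (.inl (.inr i)) (.inl (.inr j))
      have hvz := fun i j => hor (.inl (.inr i)) (.inr j)
      have hzu := fun i j => hor (.inr i) (.inl (.inl j))
      have hzv := fun i j => hor (.inr i) (.inl (.inr j))
      have hzz := fun i j => hor (.inr i) (.inr j)
      have o00 := ho 0 0
      have o01 := ho 0 1
      have o10 := ho 1 0
      have o11 := ho 1 1
      simp at o00 o01 o10 o11
      simp only [Submodule.coe_inner, Sum.elim_inl, Sum.elim_inr, Sum.inl.injEq, Sum.inr.injEq,
        reduceCtorEq, if_false] at huu huv huz hvu hvv hvz hzu hzv hzz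
      have hl0 : ∀ x : W, inner ℝ u₀ (x : V) = (0 : ℝ) := fun x => ((hW x).1 x.2).1
      have hl1 : ∀ x : W, inner ℝ v₀ (x : V) = (0 : ℝ) := fun x => ((hW x).1 x.2).2
      have hr0 : ∀ x : W, inner ℝ (x : V) u₀ = (0 : ℝ) := fun x => by
        rw [real_inner_comm, hl0]
      have hr1 : ∀ x : W, inner ℝ (x : V) v₀ = (0 : ℝ) := fun x => by
        rw [real_inner_comm, hl1]
      refine ⟨Fin.cons u₀ fun i => u i, Fin.cons v₀ fun i => v i, fun j => z j, Fin.cons b₀ b,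
        ?_, ?_, ?_, ?_⟩
      · rw [orthonormal_iff_ite]
        rintro ((i | i) | i) ((j | j) | j)
        all_goals
          try refine Fin.cases ?_ (fun i => ?_) i
        all_goals
          try refine Fin.cases ?_ (fun j => ?_) j
        all_goals
          simp [o00, o01, o10, o11, huu, huv, huz, hvu, hvv, hvz, hzu, hzv, hzz,
            hl0, hl1, hr0, hr1, eq_comm (a := (0 : Fin (m + 1)))]
      · refine Fin.cases hu₀ fun i => ?_
        simpa using congrArg Subtype.val (hu i)
      · refine Fin.cases hv₀ fun i => ?_
        simpa using congrArg Subtype.val (hv i)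
      · intro j
        simpa using congrArg Subtype.val (hz j)

/-- The normal form of a skew-symmetric endomorphism of a Euclidean vector space. -/
lemma exists_isSkewNormalForm [FiniteDimensional ℝ V] {q : ℕ} (hq : Module.finrank ℝ V = q)
    {h : V →ₗ[ℝ] V} (hh : ∀ X Y, (inner ℝ (h X) Y : ℝ) = -inner ℝ X (h Y)) :
    ∃ (e : OrthonormalBasis (Fin q) ℝ V) (b : Fin (q / 2) → ℝ), IsSkewNormalForm h e b := by
  obtain ⟨u, v, z, b, hor, hu, hv, hz⟩ := exists_skew_families (q / 2) (q % 2)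
    (Nat.mod_lt _ two_pos) V h hh (by omega)
  -- `τ` orders the planes by $|b_i|$, and `ind` interleaves the vectors `u` and `v`, with `z` at
  -- the end.
  let τ := Tuple.sort fun i => |b i|
  let ind : Fin q → (Fin (q / 2) ⊕ Fin (q / 2)) ⊕ Fin (q % 2) := fun j =>
    if hj : (j : ℕ) < 2 * (q / 2) then
      if (j : ℕ) % 2 = 0 then .inl (.inl (τ ⟨j / 2, by omega⟩))
      else .inl (.inr (τ ⟨j / 2, by omega⟩))
    else .inr ⟨j - 2 * (q / 2), by omega⟩
  have hind : Function.Injective ind := fun i j hij => by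
    ext
    simp only [ind] at hij
    split_ifs at hij with h1 h2 h3 h4 h5 h6 h7 h8 <;> simp at hij <;> omega
  obtain ⟨e, he⟩ := Orthonormal.exists_orthonormalBasis_extension_of_card_eq
    (v := Sum.elim (Sum.elim u v) z ∘ ind) (s := Set.univ) (by simp [hq])
    ((hor.comp ind hind).comp _ Subtype.val_injective)
  have he0 : ∀ i : Fin (q / 2), e ⟨2 * (i : ℕ), by omega⟩ = u (τ i) := fun i => by
    have : 2 * (i : ℕ) < 2 * (q / 2) := by omega
    rw [he _ (Set.mem_univ _)]
    simp [ind, this]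
  have he1 : ∀ i : Fin (q / 2), e ⟨2 * (i : ℕ) + 1, by omega⟩ = v (τ i) := fun i => by
    have h1 : 2 * (i : ℕ) + 1 < 2 * (q / 2) := by omega
    have h2 : (2 * (i : ℕ) + 1) / 2 = i := by omega
    rw [he _ (Set.mem_univ _)]
    simp [ind, h1, h2]
  refine ⟨e, b ∘ τ, fun i => ?_, fun i => ?_, fun j hj => ?_, fun i j hij => ?_⟩
  · rw [he0, he1, hu]; rfl
  · rw [he0, he1, hv]; rfl
  · rw [he _ (Set.mem_univ _)]
    simp [ind, not_lt.2 hj, hz]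
  · exact Tuple.monotone_sort (fun i => |b i|) hij

end NormalForm

/-! ### From the flow to linear algebra on the normal space. -/

section Geometry

variable {n : ℕ} {M : Type*} [TopologicalSpace M] [ChartedSpace (EuclideanSpace ℝ (Fin n)) M]
  [RiemannianBundle (fun x : M => TangentSpace (𝓡 n) x)]

lemma finrank_normalSpace {q : ℕ} {M : Type*} [TopologicalSpace M]
    [ChartedSpace (EuclideanSpace ℝ (Fin (q + 1))) M]
    [RiemannianBundle (fun x : M => TangentSpace (𝓡 (q + 1)) x)]
    {ξ : ∀ x : M, TangentSpace (𝓡 (q + 1)) x} {x : M} (hξ : ‖ξ x‖ = 1) :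
    Module.finrank ℝ (normalSpace ξ x) = q := by
  have hfin : Module.finrank ℝ (TangentSpace (𝓡 (q + 1)) x) = q + 1 :=
    finrank_euclideanSpace_fin
  have hfd : FiniteDimensional ℝ (TangentSpace (𝓡 (q + 1)) x) :=
    Module.finite_of_finrank_pos (by omega)
  have h0 : ξ x ≠ 0 := norm_ne_zero_iff.1 (by rw [hξ]; exact one_ne_zero)
  have h1 := Submodule.finrank_add_finrank_orthogonal (Submodule.span ℝ {ξ x})
  rw [finrank_span_singleton h0, hfin] at h1
  exact Nat.add_left_cancel (h1.trans (Nat.add_comm q 1))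

lemma mem_normalSpace {ξ : ∀ x : M, TangentSpace (𝓡 n) x} {x : M}
    (X : normalSpace ξ x) : inner ℝ (ξ x) (X : TangentSpace (𝓡 n) x) = (0 : ℝ) :=
  Submodule.mem_orthogonal_singleton_iff_inner_right.1 X.2

set_option synthInstance.maxHeartbeats 200000 in
/-- The O'Neill tensor of a Riemannian flow is skew-symmetric. -/
lemma IsRiemannianFlow.oneillTensor_skew [IsManifold (𝓡 n) ∞ M]
    [IsContMDiffRiemannianBundle (𝓡 n) ∞ (EuclideanSpace ℝ (Fin n))
      (fun x : M => TangentSpace (𝓡 n) x)]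
    {D : CovariantDerivative (𝓡 n) (EuclideanSpace ℝ (Fin n))
      (fun x : M => TangentSpace (𝓡 n) x)} (hD : IsLeviCivita D)
    {ξ : ∀ x : M, TangentSpace (𝓡 n) x} (hξ : IsRiemannianFlow ξ) (x : M)
    (X Y : normalSpace ξ x) :
    (inner ℝ (oneillTensor D ξ x X) Y : ℝ) = -inner ℝ X (oneillTensor D ξ x Y) := by
  have hXd := FiberBundle.mdifferentiableAt_extend (𝓡 n) (EuclideanSpace ℝ (Fin n))
    (X : TangentSpace (𝓡 n) x)
  have hYd := FiberBundle.mdifferentiableAt_extend (𝓡 n) (EuclideanSpace ℝ (Fin n))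
    (Y : TangentSpace (𝓡 n) x)
  have hξd : MDifferentiableAt (𝓡 n) (𝓡 n).tangent
      (fun x => (⟨x, ξ x⟩ : TangentBundle (𝓡 n) M)) x :=
    (hξ.smooth x).mdifferentiableAt (by simp)
  -- For a metric torsion-free connection, $(\mathcal L_\xi
  -- g)(X,Y)=g(\nabla_X\xi,Y)+g(X,\nabla_Y\xi)$. It is evaluated on local extensions of the two
  -- vectors, which need to be normal only at `x`.
  have hlie := hξ.lieDeriv_eq_zero _ _ x hXd hYd
    (by rw [FiberBundle.extend_apply_self]; exact mem_normalSpace X)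
    (by rw [FiberBundle.extend_apply_self]; exact mem_normalSpace Y)
  have htorX := D.torsion_eq_zero_iff.1 hD.torsion_eq_zero hξd hXd
  have htorY := D.torsion_eq_zero_iff.1 hD.torsion_eq_zero hξd hYd
  have hmet := hD.metric.mvfderiv_inner_eq ξ hXd hYd
  unfold lieDerivMetric at hlie
  rw [hmet, ← htorX, ← htorY] at hlie
  simp only [FiberBundle.extend_apply_self, inner_sub_left, inner_sub_right] at hlie
  have h1 : ∀ Z W : normalSpace ξ x, (inner ℝ (oneillTensor D ξ x Z) W : ℝ) =
      inner ℝ (D ξ x (Z : TangentSpace (𝓡 n) x)) (W : TangentSpace (𝓡 n) x) := fun Z W =>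
    Submodule.inner_orthogonalProjectionOnto_eq_of_mem_right W _
  rw [real_inner_comm _ X, h1, h1, real_inner_comm (X : TangentSpace (𝓡 n) x)]
  linarith

/-- A form that is killed by `ξ` is determined by its restriction to the normal space. -/
lemma normalPart_ne_zero {ξ : ∀ x : M, TangentSpace (𝓡 n) x} {k : ℕ}
    {η : ∀ x : M, TangentSpace (𝓡 n) x [⋀^Fin k]→L[ℝ] ℝ} {x : M}
    (hη : ∀ (v : Fin k → TangentSpace (𝓡 n) x) (i : Fin k), v i = ξ x → η x v = 0)
    (h : η x ≠ 0) : normalPart ξ η x ≠ 0 := by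
  intro h0
  apply h
  ext v
  have hdec : ∀ X : TangentSpace (𝓡 n) x, ∃ (Y : normalSpace ξ x) (a : ℝ),
      X = Y + a • ξ x := fun X => by
    obtain ⟨y, hy, z, hz, rfl⟩ := Submodule.exists_add_mem_mem_orthogonal
      (K := Submodule.span ℝ {ξ x}) X
    obtain ⟨a, rfl⟩ := Submodule.mem_span_singleton.1 hy
    exact ⟨⟨z, hz⟩, a, add_comm _ _⟩
  choose Y a hYa using fun i => hdec (v i)
  -- The arguments are replaced by their normal components one at a time; each discarded multiple of
  -- `ξ x` contributes 0.
  have hstep : ∀ s : Finset (Fin k), η x v =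
      η x (s.piecewise (fun i => (Y i : TangentSpace (𝓡 n) x)) v) := fun s => by
    induction s using Finset.induction_on with
    | empty => simp
    | insert i s hi ih =>
      rw [ih, Finset.piecewise_insert]
      set g := s.piecewise (fun i => (Y i : TangentSpace (𝓡 n) x)) v
      have hg : g = Function.update g i ((Y i : TangentSpace (𝓡 n) x) + a i • ξ x) := by
        rw [← hYa, eq_comm, Function.update_eq_self_iff]
        simp [g, hi]
      nth_rw 1 [hg]
      rw [ContinuousAlternatingMap.map_update_add, ContinuousAlternatingMap.map_update_smul,
        hη _ i (Function.update_self ..), smul_zero, add_zero]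
  rw [hstep Finset.univ, Finset.piecewise_univ]
  exact congrArg (fun α => α Y) h0

end Geometry

end RiemannianFlow

end

theorem theorem4p2 {q : ℕ} {M : Type*} [TopologicalSpace M]
    [ChartedSpace (EuclideanSpace ℝ (Fin (q + 1))) M] [IsManifold (𝓡 (q + 1)) ∞ M]
    [RiemannianBundle (fun x : M => TangentSpace (𝓡 (q + 1)) x)]
    [IsContMDiffRiemannianBundle (𝓡 (q + 1)) ∞ (EuclideanSpace ℝ (Fin (q + 1)))
      (fun x : M => TangentSpace (𝓡 (q + 1)) x)]
    (D : CovariantDerivative (𝓡 (q + 1)) (EuclideanSpace ℝ (Fin (q + 1)))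
      (fun x : M => TangentSpace (𝓡 (q + 1)) x))
    (hD : RiemannianFlow.IsLeviCivita D)
    (ξ : ∀ x : M, TangentSpace (𝓡 (q + 1)) x) (hξ : RiemannianFlow.IsRiemannianFlow ξ)
    (p : ℕ) (hp : 1 ≤ p) (hpq : p ≤ q - 1)
    (η : ∀ x : M, TangentSpace (𝓡 (q + 1)) x [⋀^Fin p]→L[ℝ] ℝ)
    (hη : RiemannianFlow.IsBasicForm ξ η) (x : M) :
    (∃ (e : OrthonormalBasis (Fin q) ℝ (RiemannianFlow.normalSpace ξ x)) (b : Fin (q / 2) → ℝ),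
      RiemannianFlow.IsSkewNormalForm (RiemannianFlow.oneillTensor D ξ x) e b) ∧
    ∀ (e f : OrthonormalBasis (Fin q) ℝ (RiemannianFlow.normalSpace ξ x)) (b : Fin (q / 2) → ℝ),
      RiemannianFlow.IsSkewNormalForm (RiemannianFlow.oneillTensor D ξ x) e b →
      (-((p : ℝ) * ((q : ℝ) - (p : ℝ)) * b ⟨q / 2 - 1, by omega⟩ ^ 2 *
          RiemannianFlow.normSqAt f η)
        ≤ RiemannianFlow.bochnerExtAt D f η) ∧
      (η x ≠ 0 → RiemannianFlow.bochnerExtAt D f η =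
          -((p : ℝ) * ((q : ℝ) - (p : ℝ)) * b ⟨q / 2 - 1, by omega⟩ ^ 2 *
            RiemannianFlow.normSqAt f η) →
        (p ≤ q / 2 → ∀ i j, |b i| = |b j|) ∧ (q / 2 = 1 → ∀ i, b i = 0)) := by
  have hfin : Module.finrank ℝ (TangentSpace (𝓡 (q + 1)) x) = q + 1 :=
    finrank_euclideanSpace_fin
  have hfd : FiniteDimensional ℝ (TangentSpace (𝓡 (q + 1)) x) :=
    Module.finite_of_finrank_pos (by omega)
  have hskew := hξ.oneillTensor_skew hD x
  refine ⟨RiemannianFlow.exists_isSkewNormalForm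
    (V := RiemannianFlow.normalSpace ξ x)
    (RiemannianFlow.finrank_normalSpace (hξ.unit x)) hskew, fun e f b he => ?_⟩
  -- From $1\le p\le q-1$ follows $q\ge2$, so `q / 2 - 1` is the last index, where $|b|$ is largest.
  obtain ⟨hle, heq⟩ := he.bochnerExt_estimate hskew f
    (l := ⟨q / 2 - 1, by omega⟩) (fun i => Fin.mk_le_mk.2 (by omega)) hp hpq
    (RiemannianFlow.normalPart ξ η x)
  refine ⟨hle, fun h0 h => ?_⟩
  obtain ⟨h1, h2⟩ := heq (RiemannianFlow.normalPart_ne_zero (hη.contract_eq_zero x) h0) h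
  exact ⟨fun _ => h1, h2⟩
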